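/- Let $d$ be a positive integer, let $R_0 \in (0,\infty]$, and let $D = \{x \in \mathbb{R}^d : \|x\| < R_0\}$, so that $D$ is an open ball centred at the origin $o$ or $D = \mathbb{R}^d$. Let $\rho : [0,R_0) \to [0,\infty)$ be a function, and let $P \subset D$ be a convex polytope with exactly $d+2$ vertices. The circumradius of a polytope is the radius of a smallest ball containing it, and its inradius is the radius of a largest ball contained in it. (i) If $\rho$ is decreasing (not necessarily strictly), then there is a convex polytope $Q = \operatorname{conv}(S_1 \cup S_2) \subset D$ whose circumradius equals that of $P$, where $S_1$ and $S_2$ are regular simplices of dimension at least $1$, centred at $o$, whose linear spans are orthogonal complements of each other in $\mathbb{R}^d$, such that \[ \int_P \rho(\|x\|)\,dx \le \int_Q \rho(\|x\|)\,dx . \] (ii) If $\rho$ is increasing (not necessarily strictly) and $P$ is $d$-dimensional, then there is a convex polytope $Q = \operatorname{conv}(S_1 \cup S_2) \subset D$ whose inradius equals that of $P$, where $S_1$ and $S_2$ are regular simplices of dimension at least $1$, centred at $o$, whose linear spans are orthogonal complements of each other in $\mathbb{R}^d$, such that \[ \int_P \rho(\|x\|)\,dx \ge \int_Q \rho(\|x\|)\,dx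 . \] -/

import Mathlib

open MeasureTheory

/-- `P` is a convex polytope: the convex hull of finitely many points. -/
def IsConvexPolytope {d : ℕ} (P : Set (EuclideanSpace ℝ (Fin d))) : Prop :=
  ∃ s : Finset (EuclideanSpace ℝ (Fin d)), P = convexHull ℝ (s : Set (EuclideanSpace ℝ (Fin d)))

/-- The set of vertices of a convex polytope, i.e. its extreme points. -/
def vertexSet {d : ℕ} (P : Set (EuclideanSpace ℝ (Fin d))) : Set (EuclideanSpace ℝ (Fin d)) :=
  P.extremePoints ℝ

/-- The radius of a largest ball contained in `P`. -/
noncomputable def inradius {d : ℕ} (P : Set (EuclideanSpace ℝ (Fin d))) : ℝ :=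
  sSup {r : ℝ | 0 ≤ r ∧ ∃ c, Metric.closedBall c r ⊆ P}

/-- The radius of a smallest ball containing `P`. -/
noncomputable def circumradius {d : ℕ} (P : Set (EuclideanSpace ℝ (Fin d))) : ℝ :=
  sInf {r : ℝ | 0 ≤ r ∧ ∃ c, P ⊆ Metric.closedBall c r}

/-- `Q = conv (S₁ ∪ S₂)` for regular simplices `S₁`, `S₂` of dimensions `k, l ≥ 1`, both centred at
the origin, whose linear spans are orthogonal complements of each other
(so that `k + l = d`). -/
def IsOrthogonalRegularHull {d : ℕ} (Q : Set (EuclideanSpace ℝ (Fin d))) : Prop :=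
  ∃ (k l : ℕ) (S₁ : Affine.Simplex ℝ (EuclideanSpace ℝ (Fin d)) k)
    (S₂ : Affine.Simplex ℝ (EuclideanSpace ℝ (Fin d)) l),
    1 ≤ k ∧ 1 ≤ l ∧ S₁.Regular ∧ S₂.Regular ∧ S₁.centroid = 0 ∧ S₂.centroid = 0 ∧
    Submodule.span ℝ (Set.range S₂.points) = (Submodule.span ℝ (Set.range S₁.points))ᗮ ∧
    Q = convexHull ℝ (S₁.closedInterior ∪ S₂.closedInterior)

/-- The interval `[0, R₀)` of real numbers, with `R₀ = ∞` allowed. -/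
def radii (R₀ : ENNReal) : Set ℝ := {τ : ℝ | 0 ≤ τ ∧ ENNReal.ofReal τ < R₀}

/-!
Both parts are proved by Steiner symmetrization about hyperplanes through the origin. A polytope
`P ⊆ ℝᵈ` with `d + 2` vertices which is not contained in a hyperplane has exactly one affine
dependence between its vertices, up to a factor, and the signs of its coefficients split the
vertices into two classes whose convex hulls meet, with at least two vertices each. Because the
dependence is unique, the endpoints of a chord of `P` parallel to `p - q`, where `p` and `q` are
vertices of the same class, have barycentric coordinates which differ only at `p` and `q`
(`IsRadonDependence.exists_combination_pair`). It follows that the Steiner symmetral of `P` in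
direction `p - q` is again a polytope with `d + 2` vertices and the same classes
(`convexHull_range_steiner`): `p` and `q` become mirror images and the other vertices are projected
to the mirror.

Such a symmetrization keeps the volume, does not decrease the volume of the intersection with any
ball about the origin, keeps inscribed balls, and keeps circumscribed balls
(`IsRadonDependence.isConcentrated_steiner`). All these conditions are closed, so among the
configurations satisfying them there is one which minimizes the sum of the squared norms of the
vertices. A symmetrization lowers this sum unless it changes nothing, so the minimizer is fixed by
the symmetrizations for all pairs in the same class
(`IsRadonDependence.exists_isConcentrated_mirror`). In a fixed configuration the reflection which
exchanges two vertices of a class fixes all other vertices. Hence both classes form regular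
simplices, the inner product between vertices of different classes is a constant, and the constant
vanishes because the points do not lie in a hyperplane
(`IsMirrorSymmetric.isOrthogonalRegularHull`).

The symmetrized polytope has the same volume, at least as much of it in each ball about the origin,
no larger circumradius and no smaller inradius. The layer cake formula turns this into the
inequalities between the integrals, and the radius is corrected by a dilation about the origin,
by a factor at least `1` for a decreasing density and at most `1` for an increasing one. If `P` is
contained in a hyperplane, its integral is `0`, and only the existence of a suitable `Q` remains; it
is obtained in the same way from any other configuration.
-/

/-! ### Signed affine dependences -/

section Dependence

variable {ι V : Type*} [Fintype ι] [AddCommGroup V] [Module ℝ V]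

/-- `w` is an affine dependence between the points `x` which is nonnegative on `I` and nonpositive
off `I`, scaled so that it exhibits a common point of `conv (x '' I)` and `conv (x '' Iᶜ)`. -/
structure IsRadonDependence (I : Finset ι) (x : ι → V) (w : ι → ℝ) : Prop where
  nonneg : ∀ i ∈ I, 0 ≤ w i
  nonpos : ∀ i ∉ I, w i ≤ 0
  sum_mem : ∑ i ∈ I, w i = 1
  sum_eq_zero : ∑ i, w i = 0
  sum_smul : ∑ i, w i • x i = 0

theorem IsRadonDependence.compl [DecidableEq ι] {I : Finset ι} {x : ι → V} {w : ι → ℝ}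
    (h : IsRadonDependence I x w) : IsRadonDependence Iᶜ x (-w) where
  nonneg i hi := by simpa using h.nonpos i (by simpa using hi)
  nonpos i hi := by simpa using h.nonneg i (by simpa using hi)
  sum_mem := by
    have := Finset.sum_add_sum_compl I w
    simp only [Pi.neg_apply, Finset.sum_neg_distrib]
    linarith [h.sum_mem, h.sum_eq_zero]
  sum_eq_zero := by simp [h.sum_eq_zero]
  sum_smul := by simp [h.sum_smul]

theorem IsRadonDependence.exists_neg {I : Finset ι} {x : ι → V} {w : ι → ℝ}
    (h : IsRadonDependence I x w) : ∃ j ∉ I, w j < 0 := by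
  classical
  by_contra! hc
  have h1 : ∑ i ∈ Iᶜ, w i = -1 := by
    have := Finset.sum_add_sum_compl I w
    linarith [h.sum_mem, h.sum_eq_zero]
  have h2 : 0 ≤ ∑ i ∈ Iᶜ, w i := Finset.sum_nonneg fun i hi => hc i (by simpa using hi)
  linarith

/-- Points `x` whose affine span is the whole `d`-dimensional space and which are `d + 2` in number
have, up to a factor, only one affine dependence. -/
theorem exists_smul_eq_of_dependence [FiniteDimensional ℝ V] {x : ι → V}
    (hcard : Fintype.card ι = Module.finrank ℝ V + 2) (hx : affineSpan ℝ (Set.range x) = ⊤)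
    {v w : ι → ℝ} (hv : ∑ i, v i = 0) (hvx : ∑ i, v i • x i = 0)
    (hw : ∑ i, w i = 0) (hwx : ∑ i, w i • x i = 0) (hw0 : w ≠ 0) : ∃ t : ℝ, v = t • w := by
  classical
  let L : (ι → ℝ) →ₗ[ℝ] ℝ × V :=
    (∑ i, LinearMap.proj i).prod (Fintype.linearCombination ℝ x)
  have hL : ∀ u, L u = (∑ i, u i, ∑ i, u i • x i) := fun u => by
    simp [L, Fintype.linearCombination_apply]
  have hsurj : LinearMap.range L = ⊤ := by
    rw [eq_top_iff]
    have key : ∀ y : V, ((1 : ℝ), y) ∈ LinearMap.range L := by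
      intro y
      have hy : y ∈ affineSpan ℝ (Set.range x) := by rw [hx]; trivial
      obtain ⟨c, hc1, hc2⟩ := eq_affineCombination_of_mem_affineSpan_of_fintype hy
      refine ⟨c, ?_⟩
      rw [hL, hc1, hc2, Finset.affineCombination_eq_linear_combination _ _ _ hc1]
    rintro ⟨t, y⟩ -
    have h2 := key 0
    have : ((t, y) : ℝ × V) = ((1 : ℝ), y) - (1 - t) • ((1 : ℝ), (0 : V)) := by
      ext <;> simp
    rw [this]
    exact Submodule.sub_mem _ (key y) (Submodule.smul_mem _ _ h2)
  have hfin := LinearMap.finrank_range_add_finrank_ker L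
  rw [hsurj, finrank_top, Module.finrank_prod, Module.finrank_self,
    Module.finrank_fintype_fun_eq_card, hcard] at hfin
  have h1 : Module.finrank ℝ (LinearMap.ker L) = 1 := by omega
  have hwk : w ∈ LinearMap.ker L := by rw [LinearMap.mem_ker, hL, hw, hwx]; rfl
  have hvk : v ∈ LinearMap.ker L := by rw [LinearMap.mem_ker, hL, hv, hvx]; rfl
  obtain ⟨t, ht⟩ := exists_smul_eq_of_finrank_eq_one h1 (x := ⟨w, hwk⟩)
    (by simpa [Subtype.ext_iff] using hw0) ⟨v, hvk⟩
  exact ⟨t, by simpa [Subtype.ext_iff] using ht.symm⟩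

theorem mem_convexHull_range_iff {x : ι → V} {y : V} :
    y ∈ convexHull ℝ (Set.range x) ↔
      ∃ c : ι → ℝ, (∀ i, 0 ≤ c i) ∧ ∑ i, c i = 1 ∧ ∑ i, c i • x i = y := by
  classical
  constructor
  · intro hy
    rw [convexHull_range_eq_exists_affineCombination] at hy
    obtain ⟨s, w, h0, h1, h2⟩ := hy
    rw [Finset.affineCombination_eq_linear_combination _ _ _ h1] at h2
    refine ⟨fun i => if i ∈ s then w i else 0, fun i => ?_, ?_, ?_⟩
    · dsimp only; split_ifs with h
      exacts [h0 i h, le_rfl]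
    · simpa using h1
    · simpa [ite_smul] using h2
  · rintro ⟨c, h0, h1, rfl⟩
    exact (convex_convexHull ℝ _).sum_mem (fun i _ => h0 i) h1
      fun i _ => subset_convexHull ℝ _ ⟨i, rfl⟩

/-- Moving along a dependence, every point of the convex hull is a convex combination in which some
point of negative weight is not used. -/
theorem IsRadonDependence.exists_combination {I : Finset ι} {x : ι → V} {w : ι → ℝ}
    (h : IsRadonDependence I x w) {y : V} (hy : y ∈ convexHull ℝ (Set.range x)) :
    ∃ c : ι → ℝ, (∀ i, 0 ≤ c i) ∧ ∑ i, c i = 1 ∧ ∑ i, c i • x i = y ∧ ∃ j, w j < 0 ∧ c j = 0 := by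
  classical
  obtain ⟨c, h0, h1, h2⟩ := mem_convexHull_range_iff.1 hy
  obtain ⟨j₀, -, hj₀⟩ := h.exists_neg
  obtain ⟨j, hj, hmin⟩ := Finset.exists_min_image (Finset.univ.filter fun i => w i < 0)
    (fun i => c i / (-w i)) ⟨j₀, by simpa using hj₀⟩
  have hj' : w j < 0 := by simpa using hj
  set t := c j / (-w j) with ht
  have ht0 : 0 ≤ t := div_nonneg (h0 j) (by linarith)
  refine ⟨fun i => c i + t * w i, fun i => ?_, ?_, ?_, j, hj', ?_⟩
  · rcases lt_or_ge (w i) 0 with hi | hi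
    · have := hmin i (by simpa using hi)
      rw [le_div_iff₀ (by linarith)] at this
      dsimp only at this ⊢
      linarith
    · exact add_nonneg (h0 i) (mul_nonneg ht0 hi)
  · rw [Finset.sum_add_distrib, ← Finset.mul_sum, h.sum_eq_zero, h1]; simp
  · simp only [add_smul, Finset.sum_add_distrib, mul_smul, ← Finset.smul_sum, h.sum_smul, h2]
    simp
  · have : w j ≠ 0 := hj'.ne
    simp only [ht]; field_simp; ring

/-- If a chord of the convex hull is parallel to `x p - x q` with `p`, `q ∈ I`, its endpoints have
coefficients that differ only at `p` and `q`. -/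
theorem IsRadonDependence.exists_combination_pair [DecidableEq ι] [FiniteDimensional ℝ V]
    {I : Finset ι} {x : ι → V}
    {w : ι → ℝ} (h : IsRadonDependence I x w)
    (hcard : Fintype.card ι = Module.finrank ℝ V + 2) (hx : affineSpan ℝ (Set.range x) = ⊤)
    {p q : ι} (hp : p ∈ I) (hq : q ∈ I) {y₁ y₂ : V} {s : ℝ}
    (hy₁ : y₁ ∈ convexHull ℝ (Set.range x)) (hy₂ : y₂ ∈ convexHull ℝ (Set.range x))
    (hs : y₁ - y₂ = s • (x p - x q)) :
    ∃ c c' : ι → ℝ, (∀ i, 0 ≤ c i) ∧ ∑ i, c i = 1 ∧ ∑ i, c i • x i = y₁ ∧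
      (∀ i, 0 ≤ c' i) ∧ ∑ i, c' i = 1 ∧ ∑ i, c' i • x i = y₂ ∧
      c = c' + s • (Pi.single p 1 - Pi.single q 1) := by
  obtain ⟨c, h0, h1, h2, j, hj, hcj⟩ := h.exists_combination hy₁
  obtain ⟨c', h0', h1', h2', j', hj', hcj'⟩ := h.exists_combination hy₂
  refine ⟨c, c', h0, h1, h2, h0', h1', h2', ?_⟩
  have hw0 : w ≠ 0 := fun hw => by simp [hw] at hj
  obtain ⟨t, ht⟩ := exists_smul_eq_of_dependence hcard hx
    (v := c - (c' + s • (Pi.single p 1 - Pi.single q 1))) (w := w) (by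
      simp [Finset.sum_sub_distrib, Finset.sum_add_distrib, h1, h1', ← Finset.mul_sum]) (by
      simp only [Pi.sub_apply, Pi.add_apply, Pi.smul_apply, sub_smul, add_smul, smul_eq_mul,
        mul_smul, Finset.sum_sub_distrib, Finset.sum_add_distrib, ← Finset.smul_sum, h2, h2']
      rw [Finset.sum_eq_single p, Finset.sum_eq_single q]
      · simp only [Pi.single_eq_same, one_smul, ← hs]; abel
      all_goals simp +contextual) h.sum_eq_zero h.sum_smul hw0
  have hne : ∀ i, w i < 0 → i ≠ p ∧ i ≠ q := fun i hi =>
    ⟨fun e => by have := h.nonneg p hp; rw [e] at hi; linarith,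
      fun e => by have := h.nonneg q hq; rw [e] at hi; linarith⟩
  have e1 := congrFun ht j
  have e2 := congrFun ht j'
  simp [hne j hj, hne j' hj', hcj, hcj'] at e1 e2
  have t0 : t = 0 := by
    have a1 := h0' j
    have a2 := h0 j'
    rcases lt_trichotomy t 0 with ht | ht | ht
    · nlinarith [mul_pos_of_neg_of_neg ht hj]
    · exact ht
    · nlinarith [mul_neg_of_pos_of_neg ht hj']
  rw [t0, zero_smul, sub_eq_zero] at ht
  exact ht

end Dependence

/-! ### Steiner symmetrization -/

section Steiner

variable {V : Type*} [NormedAddCommGroup V] [InnerProductSpace ℝ V]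

/-- The orthogonal reflection in the hyperplane through the origin with normal `u`
(the identity if `u = 0`). -/
noncomputable abbrev mirror (u : V) : V ≃ₗᵢ[ℝ] V := (Submodule.span ℝ {u})ᗮ.reflection

theorem mirror_self (u : V) : mirror u u = -u :=
  Submodule.reflection_orthogonalComplement_singleton_eq_neg u

theorem mirror_eq_self_iff {u v : V} : mirror u v = v ↔ inner ℝ u v = 0 := by
  rw [Submodule.reflection_eq_self_iff, Submodule.mem_orthogonal_singleton_iff_inner_right]

theorem mirror_add_smul {u y : V} (hy : inner ℝ u y = 0) (s : ℝ) :
    mirror u (y + s • u) = y - s • u := by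
  rw [map_add, map_smul, mirror_self, mirror_eq_self_iff.2 hy, smul_neg, sub_eq_add_neg]

theorem mirror_smul {t : ℝ} (ht : t ≠ 0) (u : V) : mirror (t • u) = mirror u := by
  have h : Submodule.span ℝ {t • u} = Submodule.span ℝ {u} :=
    Submodule.span_singleton_smul_eq (isUnit_iff_ne_zero.2 ht) u
  unfold mirror
  simp only [h]

theorem exists_orthogonal_add_smul (u v : V) :
    ∃ y : V, ∃ s : ℝ, inner ℝ u y = 0 ∧ v = y + s • u := by
  rcases eq_or_ne u 0 with rfl | hu
  · exact ⟨v, 0, by simp, by simp⟩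
  · refine ⟨v - (inner ℝ u v / inner ℝ u u) • u, inner ℝ u v / inner ℝ u u, ?_, by simp⟩
    have : inner ℝ u u ≠ 0 := inner_self_ne_zero.2 hu
    rw [inner_sub_right, inner_smul_right]
    field_simp
    ring

/-- The Steiner symmetral of `A` about the hyperplane with normal `u`: a chord of `A` in direction
`u` with endpoints `y₁`, `y₂` contributes the midpoint of `y₁` and the mirror image of `y₂`. For
convex `A` this is the usual Steiner symmetral. -/
def steinerSymmetral (u : V) (A : Set V) : Set V :=
  {z | ∃ y₁ ∈ A, ∃ y₂ ∈ A, ∃ s : ℝ, y₁ - y₂ = s • u ∧ z = (1 / 2 : ℝ) • (y₁ + mirror u y₂)}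

theorem add_smul_mem_steinerSymmetral {u y : V} {A : Set V} (hy : inner ℝ u y = 0) {s₁ s₂ : ℝ}
    (h₁ : y + s₁ • u ∈ A) (h₂ : y + s₂ • u ∈ A) :
    y + ((s₁ - s₂) / 2) • u ∈ steinerSymmetral u A := by
  refine ⟨_, h₁, _, h₂, s₁ - s₂, by module, ?_⟩
  rw [mirror_add_smul hy]
  module

theorem exists_of_add_smul_mem_steinerSymmetral {u y : V} (hu : u ≠ 0) {A : Set V}
    (hy : inner ℝ u y = 0) {s : ℝ} (h : y + s • u ∈ steinerSymmetral u A) :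
    ∃ s₁ s₂ : ℝ, y + s₁ • u ∈ A ∧ y + s₂ • u ∈ A ∧ s₁ - s₂ = 2 * s := by
  obtain ⟨y₁, h₁, y₂, h₂, t, ht, hz⟩ := h
  obtain ⟨z, a, hz0, rfl⟩ := exists_orthogonal_add_smul u y₁
  obtain rfl : y₂ = z + (a - t) • u := by
    rw [sub_eq_iff_eq_add] at ht
    rw [sub_smul, ← sub_eq_zero]
    have : y₂ = z + a • u - t • u := by rw [ht]; abel
    rw [this]; abel
  rw [mirror_add_smul hz0] at hz
  have hz' : y - z = (t / 2 - s) • u := by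
    rw [← sub_eq_zero] at hz ⊢
    rw [← hz]; module
  have huu : inner ℝ u u ≠ 0 := inner_self_ne_zero.2 hu
  have hs : t / 2 - s = 0 := by
    have : inner ℝ u (y - z) = (t / 2 - s) * inner ℝ u u := by rw [hz', inner_smul_right]
    rw [inner_sub_right, hy, hz0, sub_zero, eq_comm] at this
    exact (mul_eq_zero.1 this).resolve_right huu
  rw [hs, zero_smul, sub_eq_zero] at hz'
  exact ⟨a, a - t, hz' ▸ h₁, hz' ▸ h₂, by linarith⟩

/-- Steiner symmetrization does not lose inscribed balls. -/
theorem closedBall_subset_steinerSymmetral {u c : V} {r : ℝ} {A : Set V}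
    (h : Metric.closedBall c r ⊆ A) :
    Metric.closedBall ((1 / 2 : ℝ) • (c + mirror u c)) r ⊆ steinerSymmetral u A := by
  intro z hz
  obtain ⟨c, a, hc, rfl⟩ := exists_orthogonal_add_smul u c
  obtain ⟨z, b, hz0, rfl⟩ := exists_orthogonal_add_smul u z
  have e : (1 / 2 : ℝ) • (c + a • u + mirror u (c + a • u)) = c := by
    rw [mirror_add_smul hc]; module
  rw [e, mem_closedBall_iff_norm] at hz
  have e1 : z + b • u - c = (z - c) + b • u := by abel
  have horth : inner ℝ u (z - c) = 0 := by rw [inner_sub_right, hz0, hc, sub_zero]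
  have h2 : ‖(z - c) - b • u‖ ≤ r := by
    rw [← mirror_add_smul horth, LinearIsometryEquiv.norm_map, ← e1]; exact hz
  have m1 : z + (a + b) • u ∈ A := h (by
    rw [mem_closedBall_iff_norm]
    have : z + (a + b) • u - (c + a • u) = z + b • u - c := by module
    rw [this]; exact hz)
  have m2 : z + (a - b) • u ∈ A := h (by
    rw [mem_closedBall_iff_norm]
    have : z + (a - b) • u - (c + a • u) = z - c - b • u := by module
    rw [this]; exact h2)
  have := add_smul_mem_steinerSymmetral hz0 m1 m2
  convert this using 3
  ring

theorem norm_half_add_mirror_le (u v w : V) {r : ℝ} (hv : ‖v‖ ≤ r) (hw : ‖w‖ ≤ r) :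
    ‖(1 / 2 : ℝ) • (v + mirror u w)‖ ≤ r := by
  have := norm_add_le v (mirror u w)
  rw [LinearIsometryEquiv.norm_map] at this
  rw [norm_smul]
  norm_num
  linarith

variable {ι : Type*} [DecidableEq ι]

/-- The vertices of the Steiner symmetral with normal `x p - x q` of the polytope with vertices
`x`, for `p` and `q` of the same class: `x p` and `x q` are moved along their line to mirror
images of each other, the other points are projected to the mirror. -/
noncomputable def steiner (p q : ι) (x : ι → V) : ι → V := fun k =>
  (1 / 2 : ℝ) • (x k + mirror (x p - x q) (x (Equiv.swap p q k)))

/-- Swapping `p` and `q` moves points of the family only in direction `x p - x q`. -/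
theorem sum_smul_swap [Fintype ι] (p q : ι) (c : ι → ℝ) (x : ι → V) :
    ∑ k, c k • x (Equiv.swap p q k) = ∑ k, c k • x k - (c p - c q) • (x p - x q) := by
  rcases eq_or_ne p q with rfl | hpq
  · simp
  have h : ∀ k, c k • x (Equiv.swap p q k) = c k • x k -
      c k • ((Pi.single p 1 - Pi.single q 1 : ι → ℝ) k • (x p - x q)) := by
    intro k
    rcases eq_or_ne k p with rfl | hkp
    · rw [Equiv.swap_apply_left]; simp [hpq, smul_sub]
    rcases eq_or_ne k q with rfl | hkq
    · rw [Equiv.swap_apply_right]; simp [hkp, smul_sub]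
    · rw [Equiv.swap_apply_of_ne_of_ne hkp hkq]; simp [hkp, hkq]
  rw [Finset.sum_congr rfl fun k _ => h k, Finset.sum_sub_distrib]
  congr 1
  simp only [smul_smul, ← Finset.sum_smul]
  congr 1
  simp [mul_sub, Finset.sum_sub_distrib, Pi.single_apply]

theorem sum_smul_comp_swap [Fintype ι] (p q : ι) (c : ι → ℝ) (x : ι → V) :
    ∑ k, c (Equiv.swap p q k) • x k = ∑ k, c k • x (Equiv.swap p q k) := by
  rw [← Equiv.sum_comp (Equiv.swap p q)]
  simp

theorem sum_smul_steiner [Fintype ι] (p q : ι) (c : ι → ℝ) (x : ι → V) :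
    ∑ k, c k • steiner p q x k = (1 / 2 : ℝ) •
      (∑ k, c k • x k + mirror (x p - x q) (∑ k, c k • x (Equiv.swap p q k))) := by
  simp only [steiner, map_sum, map_smul, smul_add, Finset.smul_sum, Finset.sum_add_distrib]
  congr 1 <;> exact Finset.sum_congr rfl fun k _ => smul_comm _ _ _

theorem sum_average_smul_steiner [Fintype ι] (p q : ι) (c c' : ι → ℝ) (x : ι → V) :
    ∑ k, ((1 / 2 : ℝ) * (c k + c' (Equiv.swap p q k))) • steiner p q x k = (1 / 4 : ℝ) •
      ((∑ k, c k • x k + ∑ k, c' k • x k - (c' p - c' q) • (x p - x q)) +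
        (mirror (x p - x q) (∑ k, c k • x k + ∑ k, c' k • x k) +
          (c p - c q) • (x p - x q))) := by
  have h₁ : ∑ k, ((1 / 2 : ℝ) * (c k + c' (Equiv.swap p q k))) • x k = (1 / 2 : ℝ) •
      (∑ k, c k • x k + ∑ k, c' k • x k - (c' p - c' q) • (x p - x q)) := by
    simp only [mul_smul, add_smul, ← Finset.smul_sum, Finset.sum_add_distrib, sum_smul_comp_swap]
    rw [sum_smul_swap, add_sub_assoc]
  have h₂ : ∑ k, ((1 / 2 : ℝ) * (c k + c' (Equiv.swap p q k))) • x (Equiv.swap p q k) =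
      (1 / 2 : ℝ) • (∑ k, c k • x k + ∑ k, c' k • x k - (c p - c q) • (x p - x q)) := by
    simp only [mul_smul, add_smul, ← Finset.smul_sum, Finset.sum_add_distrib]
    rw [sum_smul_swap, Equiv.sum_comp (Equiv.swap p q) fun k => c' k • x k]
    module
  rw [sum_smul_steiner, h₁, h₂, map_smul, map_sub, map_smul (mirror _) (c p - c q), mirror_self]
  module

theorem isRadonDependence_steiner [Fintype ι] {I : Finset ι} {x : ι → V} {w : ι → ℝ}
    (h : IsRadonDependence I x w) {p q : ι} (hpq : p ∈ I ↔ q ∈ I) :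
    IsRadonDependence I (steiner p q x)
      (fun k => (1 / 2 : ℝ) * (w k + w (Equiv.swap p q k))) := by
  have hI : ∀ k, Equiv.swap p q k ∈ I ↔ k ∈ I := fun k => by
    rcases eq_or_ne k p with rfl | hkp
    · rw [Equiv.swap_apply_left, hpq]
    rcases eq_or_ne k q with rfl | hkq
    · rw [Equiv.swap_apply_right, hpq]
    · rw [Equiv.swap_apply_of_ne_of_ne hkp hkq]
  refine ⟨fun i hi => ?_, fun i hi => ?_, ?_, ?_, ?_⟩
  · have := h.nonneg i hi
    have := h.nonneg _ ((hI i).2 hi)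
    positivity
  · have := h.nonpos i hi
    have := h.nonpos _ (mt (hI i).1 hi)
    linarith
  · have : ∑ i ∈ I, w (Equiv.swap p q i) = ∑ i ∈ I, w i :=
      Finset.sum_equiv (Equiv.swap p q) (fun i => (hI i).symm) (fun i _ => rfl)
    rw [← Finset.mul_sum, Finset.sum_add_distrib, this, h.sum_mem]
    norm_num
  · rw [← Finset.mul_sum, Finset.sum_add_distrib, Equiv.sum_comp, h.sum_eq_zero]
    norm_num
  · rw [sum_average_smul_steiner, h.sum_smul]
    simp

/-- If `x p` and `x q` lie on the same side of a Radon partition, the Steiner symmetral of the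
polytope is again a polytope with the same number of vertices. The inclusion `⊇` is where the Radon
partition is needed: the endpoints of a chord parallel to `x p - x q` have coefficients which differ
only at `p` and `q`. -/
theorem convexHull_range_steiner [Fintype ι] [FiniteDimensional ℝ V] {I : Finset ι} {x : ι → V}
    {w : ι → ℝ} (h : IsRadonDependence I x w)
    (hcard : Fintype.card ι = Module.finrank ℝ V + 2) (hx : affineSpan ℝ (Set.range x) = ⊤)
    {p q : ι} (hp : p ∈ I) (hq : q ∈ I) :
    convexHull ℝ (Set.range (steiner p q x)) =
      steinerSymmetral (x p - x q) (convexHull ℝ (Set.range x)) := by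
  apply Set.Subset.antisymm
  · intro z hz
    obtain ⟨c, h0, h1, rfl⟩ := mem_convexHull_range_iff.1 hz
    refine ⟨_, mem_convexHull_range_iff.2 ⟨c, h0, h1, rfl⟩, ∑ k, c k • x (Equiv.swap p q k), ?_,
      c p - c q, ?_, sum_smul_steiner p q c x⟩
    · exact mem_convexHull_range_iff.2 ⟨c ∘ Equiv.swap p q, fun i => h0 _,
        by simpa [Equiv.sum_comp] using h1, sum_smul_comp_swap p q c x⟩
    · rw [sum_smul_swap]; abel
  · rintro z ⟨y₁, hy₁, y₂, hy₂, s, hs, rfl⟩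
    obtain ⟨c, c', h0, h1, rfl, h0', h1', rfl, hc⟩ :=
      h.exists_combination_pair hcard hx hp hq hy₁ hy₂ hs
    -- The coefficients `(c + c' ∘ swap) / 2` represent the point in terms of the moved vertices.
    refine mem_convexHull_range_iff.2 ⟨fun k => (1 / 2 : ℝ) * (c k + c' (Equiv.swap p q k)),
      fun i => ?_, ?_, ?_⟩
    · have := h0 i
      have := h0' (Equiv.swap p q i)
      positivity
    · rw [← Finset.mul_sum, Finset.sum_add_distrib, Equiv.sum_comp, h1, h1']; norm_num
    · have hcc : (c p - c q) • (x p - x q) = (c' p - c' q) • (x p - x q) +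
          (2 * s) • (x p - x q) := by
        rcases eq_or_ne p q with rfl | hpq
        · simp
        have hp' := congrFun hc p
        have hq' := congrFun hc q
        simp [hpq, hpq.symm] at hp' hq'
        rw [hp', hq']
        module
      rw [sum_average_smul_steiner, hcc, eq_add_of_sub_eq hs]
      simp only [map_add, map_smul, mirror_self]
      module

end Steiner

section SteinerMeasure

theorem isCompact_slice {V : Type*} [NormedAddCommGroup V] [NormedSpace ℝ V] {u : V}
    (hu : u ≠ 0) (y : V) {A : Set V} (hA : IsCompact A) : IsCompact {s : ℝ | y + s • u ∈ A} := by
  have : Topology.IsClosedEmbedding fun s : ℝ => y + s • u :=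
    (Homeomorph.addLeft y).isClosedEmbedding.comp (isClosedEmbedding_smul_left hu)
  exact this.isCompact_preimage hA

theorem convex_slice {V : Type*} [AddCommGroup V] [Module ℝ V] (u y : V) {A : Set V}
    (hA : Convex ℝ A) : Convex ℝ {s : ℝ | y + s • u ∈ A} := by
  have e : {s : ℝ | y + s • u ∈ A} = AffineMap.lineMap (k := ℝ) y (y + u) ⁻¹' A := by
    ext s
    simp [AffineMap.lineMap_apply, add_comm]
  rw [e]
  exact hA.affine_preimage (AffineMap.lineMap (k := ℝ) y (y + u))

variable {V : Type*} [NormedAddCommGroup V] [InnerProductSpace ℝ V] [FiniteDimensional ℝ V]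
  [MeasurableSpace V] [BorelSpace V] (μ : Measure V) [μ.IsAddHaarMeasure]

/-- Cavalieri's principle for an inequality between the lengths of parallel slices. -/
theorem measure_le_of_slices {u : V} (hu : u ≠ 0) {A B : Set V} (hA : MeasurableSet A)
    (hB : MeasurableSet B)
    (h : ∀ y : V, inner ℝ u y = 0 →
      volume {s : ℝ | y + s • u ∈ A} ≤ volume {s : ℝ | y + s • u ∈ B}) : μ A ≤ μ B := by
  let W : Submodule ℝ V := (Submodule.span ℝ {u})ᗮ
  have hW : ∀ y : W, inner ℝ u (y : V) = 0 := fun y =>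
    Submodule.mem_orthogonal_singleton_iff_inner_right.1 y.2
  let L₀ : W × ℝ →ₗ[ℝ] V := W.subtype.coprod (LinearMap.toSpanSingleton ℝ V u)
  have hL₀ : ∀ z, L₀ z = (z.1 : V) + z.2 • u := fun z => by simp [L₀]
  have hinj : Function.Injective L₀ := by
    rw [← LinearMap.ker_eq_bot, LinearMap.ker_eq_bot']
    rintro ⟨y, s⟩ hz
    rw [hL₀] at hz
    have h1 : inner ℝ u ((y : V) + s • u) = 0 := by
      rw [show (y : V) + s • u = 0 from hz, inner_zero_right]
    rw [inner_add_right, hW, inner_smul_right, zero_add] at h1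
    have hs : s = 0 := (mul_eq_zero.1 h1).resolve_right (inner_self_ne_zero.2 hu)
    subst hs
    simpa using hz
  have hsurj : Function.Surjective L₀ := fun v => by
    obtain ⟨y, s, hy, rfl⟩ := exists_orthogonal_add_smul u v
    exact ⟨(⟨y, Submodule.mem_orthogonal_singleton_iff_inner_right.2 hy⟩, s), hL₀ _⟩
  let L : (W × ℝ) ≃L[ℝ] V := (LinearEquiv.ofBijective L₀ ⟨hinj, hsurj⟩).toContinuousLinearEquiv
  have hL : ∀ z, L z = (z.1 : V) + z.2 • u := hL₀
  let ν : Measure (W × ℝ) := (volume : Measure W).prod volume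
  have hν : (ν.map L).IsAddHaarMeasure := L.isAddHaarMeasure_map ν
  have hμ := Measure.isAddLeftInvariant_eq_smul μ (ν.map L)
  have hLm : Measurable L := L.continuous.measurable
  rw [hμ, Measure.smul_apply, Measure.smul_apply, Measure.map_apply hLm hA,
    Measure.map_apply hLm hB, Measure.prod_apply (hLm hA), Measure.prod_apply (hLm hB)]
  refine smul_le_smul_of_nonneg_left (lintegral_mono fun y => ?_) zero_le
  have := h y (hW y)
  convert this using 2 <;> · ext s; simp [hL]

/-- A convex set of reals which contains all half differences of a set is at least as long. -/
theorem volume_slice_le {A B : Set ℝ} (hA : IsCompact A) (hB : Convex ℝ B)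
    (h : ∀ s₁ ∈ A, ∀ s₂ ∈ A, (s₁ - s₂) / 2 ∈ B) : volume A ≤ volume B := by
  rcases A.eq_empty_or_nonempty with rfl | hne
  · simp
  obtain ⟨a, ha, ha'⟩ := hA.exists_isMinOn hne continuousOn_id
  obtain ⟨b, hb, hb'⟩ := hA.exists_isMaxOn hne continuousOn_id
  have h1 : A ⊆ Set.Icc a b := fun s hs => ⟨ha' hs, hb' hs⟩
  have h2 : Set.Icc ((a - b) / 2) ((b - a) / 2) ⊆ B := by
    have := hB.ordConnected.out (h a ha b hb) (h b hb a ha)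
    exact this
  calc volume A ≤ volume (Set.Icc a b) := measure_mono h1
    _ = volume (Set.Icc ((a - b) / 2) ((b - a) / 2)) := by
      rw [Real.volume_Icc, Real.volume_Icc]; congr 1; ring
    _ ≤ volume B := measure_mono h2

/-- A set of reals whose doubles are differences of a convex set is at most as long. -/
theorem volume_slice_ge {A B : Set ℝ} (hA : Convex ℝ A) (hB : IsCompact B)
    (h : ∀ s ∈ B, ∃ s₁ ∈ A, ∃ s₂ ∈ A, s₁ - s₂ = 2 * s) : volume B ≤ volume A := by
  rcases B.eq_empty_or_nonempty with rfl | hne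
  · simp
  obtain ⟨m, hm, hm'⟩ := hB.exists_isMaxOn hne continuous_abs.continuousOn
  have h1 : B ⊆ Set.Icc (-|m|) |m| := fun s hs => abs_le.1 (hm' hs)
  obtain ⟨s₁, hs₁, s₂, hs₂, hs⟩ := h m hm
  have h2 : Set.uIcc s₁ s₂ ⊆ A := by
    rw [← segment_eq_uIcc]; exact hA.segment_subset hs₁ hs₂
  calc volume B ≤ volume (Set.Icc (-|m|) |m|) := measure_mono h1
    _ = volume (Set.uIcc s₁ s₂) := by
      rw [Real.volume_Icc, Set.uIcc, Real.volume_Icc, max_sub_min_eq_abs', hs, abs_mul, abs_two]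
      congr 1; ring
    _ ≤ volume A := measure_mono h2

/-- Steiner symmetrization moves mass towards the origin. -/
theorem measure_inter_closedBall_le_steinerSymmetral {u : V} (hu : u ≠ 0) {A : Set V}
    (hA : IsCompact A) (hS : IsCompact (steinerSymmetral u A))
    (hS' : Convex ℝ (steinerSymmetral u A)) (t : ℝ) :
    μ (A ∩ Metric.closedBall 0 t) ≤ μ (steinerSymmetral u A ∩ Metric.closedBall 0 t) := by
  have hb : IsCompact (Metric.closedBall (0 : V) t) := isCompact_closedBall 0 t
  refine measure_le_of_slices μ hu (hA.inter hb).measurableSet (hS.inter hb).measurableSet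
    fun y hy => ?_
  refine volume_slice_le (isCompact_slice hu y (hA.inter hb))
    (convex_slice u y (hS'.inter (convex_closedBall 0 t))) fun s₁ h₁ s₂ h₂ => ?_
  refine ⟨add_smul_mem_steinerSymmetral hy h₁.1 h₂.1, ?_⟩
  have e₁ := mem_closedBall_zero_iff.1 h₁.2
  have e₂ := mem_closedBall_zero_iff.1 h₂.2
  have := norm_half_add_mirror_le u _ _ e₁ e₂
  rw [mirror_add_smul hy] at this
  rw [mem_closedBall_zero_iff]
  have e : y + ((s₁ - s₂) / 2) • u = (1 / 2 : ℝ) • (y + s₁ • u + (y - s₂ • u)) := by module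
  rw [e]
  exact this

theorem measure_steinerSymmetral_le {u : V} (hu : u ≠ 0) {A : Set V}
    (hA : IsCompact A) (hA' : Convex ℝ A) (hS : IsCompact (steinerSymmetral u A)) :
    μ (steinerSymmetral u A) ≤ μ A := by
  refine measure_le_of_slices μ hu hS.measurableSet hA.measurableSet fun y hy => ?_
  refine volume_slice_ge (convex_slice u y hA') (isCompact_slice hu y hS) fun s hs => ?_
  obtain ⟨s₁, s₂, h₁, h₂, h⟩ := exists_of_add_smul_mem_steinerSymmetral hu hy hs
  exact ⟨s₁, h₁, s₂, h₂, h⟩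

end SteinerMeasure

/-! ### Configurations at least as concentrated as a given one -/

section Concentrated

variable {V : Type*} [NormedAddCommGroup V] [InnerProductSpace ℝ V] [MeasurableSpace V]

/-- The polytope with vertices `x'` is obtained from the one with vertices `x` by moving mass
towards the origin, without gaining volume, losing inscribed balls or losing circumscribed balls;
the balls may only move towards the origin. -/
structure IsConcentrated {ι : Type*} (μ : Measure V) (x x' : ι → V) : Prop where
  measure_le : μ (convexHull ℝ (Set.range x')) ≤ μ (convexHull ℝ (Set.range x))
  le_measure_inter : ∀ t : ℝ, μ (convexHull ℝ (Set.range x) ∩ Metric.closedBall 0 t) ≤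
    μ (convexHull ℝ (Set.range x') ∩ Metric.closedBall 0 t)
  inscribed : ∀ c r, Metric.closedBall c r ⊆ convexHull ℝ (Set.range x) →
    ∃ c', ‖c'‖ ≤ ‖c‖ ∧ Metric.closedBall c' r ⊆ convexHull ℝ (Set.range x')
  circumscribed : ∀ c r, (∀ k, ‖x k - c‖ ≤ r) → ∃ c', ‖c'‖ ≤ ‖c‖ ∧ ∀ k, ‖x' k - c'‖ ≤ r

variable {ι : Type*} {μ : Measure V}

theorem IsConcentrated.refl (x : ι → V) : IsConcentrated μ x x :=
  ⟨le_rfl, fun _ => le_rfl, fun c _ h => ⟨c, le_rfl, h⟩, fun c _ h => ⟨c, le_rfl, h⟩⟩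

theorem IsConcentrated.trans {x x' x'' : ι → V} (h : IsConcentrated μ x x')
    (h' : IsConcentrated μ x' x'') : IsConcentrated μ x x'' where
  measure_le := h'.measure_le.trans h.measure_le
  le_measure_inter t := (h.le_measure_inter t).trans (h'.le_measure_inter t)
  inscribed c r hc := by
    obtain ⟨c', hc', h1⟩ := h.inscribed c r hc
    obtain ⟨c'', hc'', h2⟩ := h'.inscribed c' r h1
    exact ⟨c'', hc''.trans hc', h2⟩
  circumscribed c r hc := by
    obtain ⟨c', hc', h1⟩ := h.circumscribed c r hc
    obtain ⟨c'', hc'', h2⟩ := h'.circumscribed c' r h1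
    exact ⟨c'', hc''.trans hc', h2⟩

theorem IsConcentrated.norm_le {x x' : ι → V} (h : IsConcentrated μ x x') {M : ℝ}
    (hx : ∀ k, ‖x k‖ ≤ M) (k : ι) : ‖x' k‖ ≤ M := by
  obtain ⟨c, hc, h1⟩ := h.circumscribed 0 M (by simpa using hx)
  rw [norm_zero, norm_le_zero_iff] at hc
  simpa [hc] using h1 k

/-- If two points of a class coincided, the dependence between them would be a second one. -/
theorem IsRadonDependence.ne_of_mem {ι V : Type*} [Fintype ι] [AddCommGroup V]
    [Module ℝ V] [FiniteDimensional ℝ V] {I : Finset ι} {x : ι → V} {w : ι → ℝ}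
    (h : IsRadonDependence I x w) (hcard : Fintype.card ι = Module.finrank ℝ V + 2)
    (hx : affineSpan ℝ (Set.range x) = ⊤) {p q : ι} (hp : p ∈ I) (hq : q ∈ I) (hpq : p ≠ q) :
    x p ≠ x q := by
  classical
  intro e
  obtain ⟨j, hj, hj'⟩ := h.exists_neg
  have hw0 : w ≠ 0 := fun hw => by simp [hw] at hj'
  obtain ⟨t, ht⟩ := exists_smul_eq_of_dependence hcard hx
    (v := Pi.single p 1 - Pi.single q 1) (w := w) (by simp) (by
      simp only [Pi.sub_apply, sub_smul, Finset.sum_sub_distrib]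
      rw [Finset.sum_eq_single p, Finset.sum_eq_single q]
      · simp [e]
      all_goals simp +contextual) h.sum_eq_zero h.sum_smul hw0
  have hpj : j ≠ p := fun e => hj (e ▸ hp)
  have hqj : j ≠ q := fun e => hj (e ▸ hq)
  have h1 := congrFun ht j
  have h2 := congrFun ht p
  simp [hpj, hqj, hj'.ne] at h1
  simp [h1, hpq] at h2

theorem IsRadonDependence.isConcentrated_steiner [FiniteDimensional ℝ V] [BorelSpace V]
    [μ.IsAddHaarMeasure] [Fintype ι] [DecidableEq ι]
    {I : Finset ι} {x : ι → V} {w : ι → ℝ} (h : IsRadonDependence I x w)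
    (hcard : Fintype.card ι = Module.finrank ℝ V + 2) (hx : affineSpan ℝ (Set.range x) = ⊤)
    {p q : ι} (hpq : p ∈ I ↔ q ∈ I) (hne : p ≠ q) : IsConcentrated μ x (steiner p q x) := by
  wlog hp : p ∈ I generalizing I w
  · exact this h.compl (by simp [hpq]) (by simpa using hp)
  have hq := hpq.1 hp
  have hu : x p - x q ≠ 0 := sub_ne_zero.2 (h.ne_of_mem hcard hx hp hq hne)
  have hS := convexHull_range_steiner h hcard hx hp hq
  have hA : IsCompact (convexHull ℝ (Set.range x)) := (Set.finite_range x).isCompact_convexHull ℝ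
  have hSc : IsCompact (steinerSymmetral (x p - x q) (convexHull ℝ (Set.range x))) := by
    rw [← hS]; exact (Set.finite_range _).isCompact_convexHull ℝ
  have hSc' : Convex ℝ (steinerSymmetral (x p - x q) (convexHull ℝ (Set.range x))) := by
    rw [← hS]; exact convex_convexHull ℝ _
  have hc : ∀ c : V, ‖(1 / 2 : ℝ) • (c + mirror (x p - x q) c)‖ ≤ ‖c‖ := fun c =>
    norm_half_add_mirror_le _ _ _ le_rfl le_rfl
  refine ⟨?_, fun t => ?_, fun c r hcr => ?_, fun c r hcr => ?_⟩
  · rw [hS]; exact measure_steinerSymmetral_le μ hu hA (convex_convexHull ℝ _) hSc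
  · rw [hS]; exact measure_inter_closedBall_le_steinerSymmetral μ hu hA hSc hSc' t
  · exact ⟨_, hc c, by rw [hS]; exact closedBall_subset_steinerSymmetral hcr⟩
  · refine ⟨_, hc c, fun k => ?_⟩
    have := norm_half_add_mirror_le (x p - x q) _ _ (hcr k) (hcr (Equiv.swap p q k))
    convert this using 2
    rw [steiner, map_sub]
    module

end Concentrated

/-! ### Compactness and the minimizing configuration -/

section Compactness

theorem IsCompact.isClosed_setOf_exists {X Y : Type*} [TopologicalSpace X] [TopologicalSpace Y]
    {S : Set Y} (hS : IsCompact S) {C : Set (X × Y)} (hC : IsClosed C) :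
    IsClosed {x | ∃ y ∈ S, (x, y) ∈ C} := by
  have : CompactSpace S := isCompact_iff_compactSpace.1 hS
  have h := isClosedMap_fst_of_compactSpace (X := X) (Y := S) _
    (hC.preimage (continuous_id.prodMap continuous_subtype_val))
  convert h using 1
  ext x
  simp

variable {ι : Type*} [Fintype ι] {V : Type*} [NormedAddCommGroup V] [InnerProductSpace ℝ V]

theorem isClosed_setOf_mem_convexHull_range :
    IsClosed {z : (ι → V) × V | z.2 ∈ convexHull ℝ (Set.range z.1)} := by
  have : {z : (ι → V) × V | z.2 ∈ convexHull ℝ (Set.range z.1)} = {z | ∃ c ∈ stdSimplex ℝ ι,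
      (z, c) ∈ {a : ((ι → V) × V) × (ι → ℝ) | ∑ i, a.2 i • a.1.1 i = a.1.2}} := by
    ext z
    rw [Set.mem_ofPred_eq, mem_convexHull_range_iff]
    simp [stdSimplex, and_assoc]
  rw [this]
  exact (isCompact_stdSimplex ℝ ι).isClosed_setOf_exists
    (isClosed_eq (by fun_prop) (by fun_prop))

theorem IsRadonDependence.mem_Icc {I : Finset ι} {x : ι → V} {w : ι → ℝ}
    (h : IsRadonDependence I x w) : w ∈ Set.pi Set.univ fun _ => Set.Icc (-1 : ℝ) 1 := by
  classical
  intro i _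
  by_cases hi : i ∈ I
  · have h1 := h.nonneg i hi
    have h2 := Finset.single_le_sum h.nonneg hi
    rw [h.sum_mem] at h2
    exact ⟨by linarith, h2⟩
  · have h1 := h.nonpos i hi
    have h2 := Finset.single_le_sum h.compl.nonneg (by simpa using hi : i ∈ Iᶜ)
    rw [h.compl.sum_mem, Pi.neg_apply] at h2
    exact ⟨by linarith, by linarith⟩

theorem isClosed_setOf_isRadonDependence (I : Finset ι) :
    IsClosed {x : ι → V | ∃ w, IsRadonDependence I x w} := by
  have : {x : ι → V | ∃ w, IsRadonDependence I x w} =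
      {x | ∃ w ∈ Set.pi Set.univ fun _ => Set.Icc (-1 : ℝ) 1,
        (x, w) ∈ {a : (ι → V) × (ι → ℝ) | IsRadonDependence I a.1 a.2}} := by
    ext x
    exact ⟨fun ⟨w, hw⟩ => ⟨w, hw.mem_Icc, hw⟩, fun ⟨w, _, hw⟩ => ⟨w, hw⟩⟩
  rw [this]
  refine (isCompact_univ_pi fun _ => isCompact_Icc).isClosed_setOf_exists ?_
  have : {a : (ι → V) × (ι → ℝ) | IsRadonDependence I a.1 a.2} =
      {a | (∀ i ∈ I, 0 ≤ a.2 i) ∧ (∀ i ∉ I, a.2 i ≤ 0) ∧ ∑ i ∈ I, a.2 i = 1 ∧ ∑ i, a.2 i = 0 ∧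
        ∑ i, a.2 i • a.1 i = 0} := by
    ext a
    exact ⟨fun h => ⟨h.1, h.2, h.3, h.4, h.5⟩, fun h => ⟨h.1, h.2.1, h.2.2.1, h.2.2.2.1, h.2.2.2.2⟩⟩
  rw [this]
  refine IsClosed.inter ?_ (IsClosed.inter ?_ (IsClosed.inter ?_ (IsClosed.inter ?_ ?_)))
  · change IsClosed {a : (ι → V) × (ι → ℝ) | ∀ i ∈ I, 0 ≤ a.2 i}
    simp only [Set.ofPred_forall]
    exact isClosed_iInter fun i => isClosed_iInter fun _ =>
      isClosed_le continuous_const (by fun_prop)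
  · change IsClosed {a : (ι → V) × (ι → ℝ) | ∀ i ∉ I, a.2 i ≤ 0}
    simp only [Set.ofPred_forall]
    exact isClosed_iInter fun i => isClosed_iInter fun _ =>
      isClosed_le (by fun_prop) continuous_const
  all_goals exact isClosed_eq (by fun_prop) (by fun_prop)

/-- A point deep inside a polytope remains inside when the vertices are moved a little. -/
theorem mem_convexHull_range_of_closedBall_subset [FiniteDimensional ℝ V] {x x' : ι → V} {y : V}
    {ε : ℝ} (hy : Metric.closedBall y ε ⊆ convexHull ℝ (Set.range x))
    (h : ∀ k, ‖x k - x' k‖ ≤ ε) (hε : 0 ≤ ε) : y ∈ convexHull ℝ (Set.range x') := by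
  by_contra hyx
  obtain ⟨f, a, hfa, hfy⟩ := geometric_hahn_banach_closed_point (convex_convexHull ℝ _)
    ((Set.finite_range x').isClosed_convexHull ℝ) hyx
  obtain ⟨g, rfl⟩ := (InnerProductSpace.toDual ℝ V).surjective f
  simp only [InnerProductSpace.toDual_apply_apply] at hfa hfy
  obtain ⟨c, h0, h1, h2⟩ := mem_convexHull_range_iff.1 (hy (by
    rw [mem_closedBall_iff_norm, add_sub_cancel_left, norm_smul, norm_div, norm_norm,
      Real.norm_of_nonneg hε]
    rcases eq_or_ne ‖g‖ 0 with hg | hg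
    · simpa [hg] using hε
    · rw [div_mul_cancel₀ _ hg] :
      y + (ε / ‖g‖) • g ∈ Metric.closedBall y ε))
  have h3 : inner ℝ g (y + (ε / ‖g‖) • g) = inner ℝ g y + ε * ‖g‖ := by
    rw [inner_add_right, inner_smul_right, real_inner_self_eq_norm_sq]
    rcases eq_or_ne ‖g‖ 0 with hg | hg
    · simp [hg]
    · field_simp
  have h4 := hfa _ (mem_convexHull_range_iff.2 ⟨c, h0, h1, rfl⟩)
  have h5 : inner ℝ g (∑ i, c i • x i) - inner ℝ g (∑ i, c i • x' i) ≤ ε * ‖g‖ := by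
    rw [← inner_sub_right, ← Finset.sum_sub_distrib]
    simp only [← smul_sub]
    refine (real_inner_le_norm _ _).trans ?_
    rw [mul_comm]
    refine mul_le_mul_of_nonneg_right ?_ (norm_nonneg _)
    calc ‖∑ i, c i • (x i - x' i)‖ ≤ ∑ i, c i * ε := by
          refine norm_sum_le_of_le _ fun i _ => ?_
          rw [norm_smul, Real.norm_of_nonneg (h0 i)]
          exact mul_le_mul_of_nonneg_left (h i) (h0 i)
      _ = ε := by rw [← Finset.sum_mul, h1, one_mul]
  rw [h2, h3] at h5
  linarith

/-- Symmetrization lowers the sum of the squared norms of the vertices. -/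
theorem sum_norm_sq_steiner [DecidableEq ι] (p q : ι) (x : ι → V) :
    ∑ k, ‖steiner p q x k‖ ^ 2 = ∑ k, ‖x k‖ ^ 2 -
      (1 / 4) * ∑ k, ‖x k - mirror (x p - x q) (x (Equiv.swap p q k))‖ ^ 2 := by
  have h : ∀ k, ‖steiner p q x k‖ ^ 2 = (1 / 2) * ‖x k‖ ^ 2 +
      (1 / 2) * ‖x (Equiv.swap p q k)‖ ^ 2 -
      (1 / 4) * ‖x k - mirror (x p - x q) (x (Equiv.swap p q k))‖ ^ 2 := by
    intro k
    have := parallelogram_law_with_norm ℝ (x k) (mirror (x p - x q) (x (Equiv.swap p q k)))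
    rw [LinearIsometryEquiv.norm_map] at this
    rw [steiner, norm_smul, mul_pow]
    norm_num
    linarith
  rw [Finset.sum_congr rfl fun k _ => h k, Finset.sum_sub_distrib, Finset.sum_add_distrib,
    ← Finset.mul_sum, ← Finset.mul_sum, ← Finset.mul_sum,
    Equiv.sum_comp (Equiv.swap p q) fun k => ‖x k‖ ^ 2]
  ring

variable [FiniteDimensional ℝ V] [MeasurableSpace V] [BorelSpace V]

/-- The measure of a polytope is an upper semicontinuous function of its vertices. -/
theorem isClosed_setOf_le_measure_convexHull (μ : Measure V) [IsFiniteMeasureOnCompacts μ]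
    (v : ENNReal) : IsClosed {x : ι → V | v ≤ μ (convexHull ℝ (Set.range x))} := by
  rw [← isOpen_compl_iff, isOpen_iff_mem_nhds]
  intro x hx
  have hx' : μ (convexHull ℝ (Set.range x)) < v := by simpa using hx
  have hc : IsCompact (convexHull ℝ (Set.range x)) := (Set.finite_range x).isCompact_convexHull ℝ
  have h1 := (tendsto_measure_cthickening_of_isCompact (μ := μ) hc).eventually_lt_const hx'
  obtain ⟨δ, hδ, h2⟩ := Metric.eventually_nhds_iff.1 h1
  have h3 := @h2 (δ / 2) (by rw [Real.dist_eq, sub_zero, abs_of_pos] <;> linarith)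
  refine Filter.mem_of_superset (Metric.ball_mem_nhds x (half_pos hδ)) fun x' hx'' => ?_
  suffices h : convexHull ℝ (Set.range x') ⊆
      Metric.cthickening (δ / 2) (convexHull ℝ (Set.range x)) by
    simpa using (measure_mono h).trans_lt h3
  refine convexHull_min ?_ ((convex_convexHull ℝ _).cthickening _)
  rintro _ ⟨k, rfl⟩
  exact Metric.mem_cthickening_of_dist_le _ (x k) _ _ (subset_convexHull ℝ _ ⟨k, rfl⟩)
    ((dist_le_pi_dist x' x k).trans (Metric.mem_ball.1 hx'').le)

/-- The measure of a polytope is a lower semicontinuous function of its vertices. -/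
theorem isClosed_setOf_measure_convexHull_le (μ : Measure V) [μ.IsAddHaarMeasure]
    (v : ENNReal) : IsClosed {x : ι → V | μ (convexHull ℝ (Set.range x)) ≤ v} := by
  rw [← isOpen_compl_iff, isOpen_iff_mem_nhds]
  intro x hx
  have hx' : v < μ (convexHull ℝ (Set.range x)) := by simpa using hx
  rw [← measure_interior_of_null_frontier ((convex_convexHull ℝ _).addHaar_frontier μ)] at hx'
  obtain ⟨K, hKs, hK, hvK⟩ := isOpen_interior.exists_lt_isCompact hx'
  obtain ⟨δ, hδ, hKδ⟩ := hK.exists_cthickening_subset_open isOpen_interior hKs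
  refine Filter.mem_of_superset (Metric.ball_mem_nhds x hδ) fun x' hx'' => ?_
  suffices h : K ⊆ convexHull ℝ (Set.range x') by
    simpa using hvK.trans_le (measure_mono h)
  intro y hy
  refine mem_convexHull_range_of_closedBall_subset (x := x) (ε := δ)
    (((Metric.closedBall_subset_cthickening hy δ).trans hKδ).trans interior_subset)
    (fun k => ?_) hδ.le
  rw [← dist_eq_norm, dist_comm]
  exact (dist_le_pi_dist x' x k).trans (Metric.mem_ball.1 hx'').le

theorem isClosed_setOf_isConcentrated (μ : Measure V) [μ.IsAddHaarMeasure] (x : ι → V) :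
    IsClosed {x' : ι → V | IsConcentrated μ x x'} := by
  have e : {x' : ι → V | IsConcentrated μ x x'} =
      {x' | μ (convexHull ℝ (Set.range x')) ≤ μ (convexHull ℝ (Set.range x))} ∩
      ({x' | ∀ t : ℝ, μ (convexHull ℝ (Set.range x) ∩ Metric.closedBall 0 t) ≤
        μ.restrict (Metric.closedBall 0 t) (convexHull ℝ (Set.range x'))} ∩
      ({x' | ∀ c r, Metric.closedBall c r ⊆ convexHull ℝ (Set.range x) →
        ∃ c' ∈ Metric.closedBall (0 : V) ‖c‖, (x', c') ∈ {a : (ι → V) × V |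
          ∀ z : V, ‖z‖ ≤ r → a.2 + z ∈ convexHull ℝ (Set.range a.1)}} ∩
      {x' | ∀ c r, (∀ k, ‖x k - c‖ ≤ r) →
        ∃ c' ∈ Metric.closedBall (0 : V) ‖c‖, (x', c') ∈ {a : (ι → V) × V |
          ∀ k, ‖a.1 k - a.2‖ ≤ r}})) := by
    have hr : ∀ (t : ℝ) (x' : ι → V),
        μ.restrict (Metric.closedBall 0 t) (convexHull ℝ (Set.range x')) =
          μ (convexHull ℝ (Set.range x') ∩ Metric.closedBall 0 t) := fun t x' =>
      Measure.restrict_apply ((Set.finite_range x').isClosed_convexHull ℝ).measurableSet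
    have hb : ∀ (c : V) (r : ℝ) (A : Set V), Metric.closedBall c r ⊆ A ↔
        ∀ z : V, ‖z‖ ≤ r → c + z ∈ A := fun c r A =>
      ⟨fun h z hz => h (by simpa using hz), fun h z hz => by
        simpa using h (z - c) (by simpa [dist_eq_norm] using hz)⟩
    ext x'
    simp only [hr, Set.mem_inter_iff, Set.mem_ofPred_eq, mem_closedBall_zero_iff, ← hb]
    exact ⟨fun h => ⟨h.1, h.2, h.3, h.4⟩, fun h => ⟨h.1, h.2.1,
      h.2.2.1, h.2.2.2⟩⟩
  rw [e]
  refine (isClosed_setOf_measure_convexHull_le μ _).inter (IsClosed.inter ?_ (IsClosed.inter ?_ ?_))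
  · rw [Set.ofPred_forall]
    exact isClosed_iInter fun t => isClosed_setOf_le_measure_convexHull _ _
  · simp only [Set.ofPred_forall]
    refine isClosed_iInter fun c => isClosed_iInter fun r => isClosed_iInter fun _ =>
      (isCompact_closedBall _ _).isClosed_setOf_exists ?_
    refine isClosed_iInter fun z => isClosed_iInter fun _ => ?_
    exact isClosed_setOf_mem_convexHull_range.preimage
      (f := fun a : (ι → V) × V => (a.1, a.2 + z)) (by fun_prop)
  · simp only [Set.ofPred_forall]
    refine isClosed_iInter fun c => isClosed_iInter fun r => isClosed_iInter fun _ =>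
      (isCompact_closedBall _ _).isClosed_setOf_exists ?_
    exact isClosed_iInter fun k => isClosed_le (by fun_prop) continuous_const

theorem affineSpan_eq_top_iff_measure_pos {ι : Type*} (μ : Measure V) [μ.IsAddHaarMeasure]
    {x : ι → V} : affineSpan ℝ (Set.range x) = ⊤ ↔ 0 < μ (convexHull ℝ (Set.range x)) := by
  rw [← interior_convexHull_nonempty_iff_affineSpan_eq_top,
    ← measure_interior_of_null_frontier ((convex_convexHull ℝ _).addHaar_frontier μ),
    isOpen_interior.measure_pos_iff μ]

theorem IsConcentrated.affineSpan_eq_top {μ : Measure V} [μ.IsAddHaarMeasure] {x x' : ι → V}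
    (h : IsConcentrated μ x x') (hx : affineSpan ℝ (Set.range x) = ⊤) :
    affineSpan ℝ (Set.range x') = ⊤ := by
  rw [affineSpan_eq_top_iff_measure_pos μ] at hx ⊢
  obtain ⟨t, ht⟩ :=
    ((Set.finite_range x).isCompact_convexHull ℝ).isBounded.subset_closedBall (0 : V)
  have := h.le_measure_inter t
  rw [Set.inter_eq_left.2 ht] at this
  exact hx.trans_le (this.trans (measure_mono Set.inter_subset_left))

/-- The configuration `x` is not changed by symmetrization with respect to any two points which lie
both in the class `I` or both outside it. -/
def IsMirrorSymmetric {ι V : Type*} [DecidableEq ι] [NormedAddCommGroup V]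
    [InnerProductSpace ℝ V] (I : Finset ι) (x : ι → V) : Prop :=
  ∀ p q, (p ∈ I ↔ q ∈ I) → ∀ k, mirror (x p - x q) (x (Equiv.swap p q k)) = x k

/-- Among the configurations at least as concentrated as `x`, one minimizing the sum of the squared
norms of the vertices is fixed by all symmetrizations. -/
theorem IsRadonDependence.exists_isConcentrated_mirror (μ : Measure V) [μ.IsAddHaarMeasure]
    [DecidableEq ι] {I : Finset ι} {x : ι → V} {w : ι → ℝ} (h : IsRadonDependence I x w)
    (hcard : Fintype.card ι = Module.finrank ℝ V + 2) (hx : affineSpan ℝ (Set.range x) = ⊤) :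
    ∃ x' : ι → V, IsConcentrated μ x x' ∧ (∃ w', IsRadonDependence I x' w') ∧
      IsMirrorSymmetric I x' := by
  let K : Set (ι → V) := {x' | ∃ w, IsRadonDependence I x' w} ∩ {x' | IsConcentrated μ x x'}
  have hK : IsCompact K := by
    refine Metric.isCompact_of_isClosed_isBounded
      ((isClosed_setOf_isRadonDependence I).inter (isClosed_setOf_isConcentrated μ x)) ?_
    refine Metric.isBounded_closedBall.subset (?_ : K ⊆ Metric.closedBall 0 ‖x‖)
    rintro x' ⟨-, hx'⟩
    rw [mem_closedBall_zero_iff, pi_norm_le_iff_of_nonneg (norm_nonneg _)]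
    exact hx'.norm_le (norm_le_pi_norm x)
  obtain ⟨x', ⟨⟨w', hw'⟩, hx'⟩, hmin⟩ := hK.exists_isMinOn ⟨x, ⟨w, h⟩, .refl x⟩
    (f := fun y : ι → V => ∑ k, ‖y k‖ ^ 2) (by fun_prop)
  refine ⟨x', hx', ⟨w', hw'⟩, fun p q hpq k => ?_⟩
  rcases eq_or_ne p q with rfl | hne
  · rw [sub_self, Equiv.swap_self, Equiv.refl_apply, mirror_eq_self_iff, inner_zero_left]
  have hspan := hx'.affineSpan_eq_top hx
  have hle := hmin ⟨⟨_, isRadonDependence_steiner hw' hpq⟩,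
    hx'.trans (hw'.isConcentrated_steiner hcard hspan hpq hne)⟩
  simp only [Set.mem_ofPred_eq, sum_norm_sq_steiner] at hle
  have h0 : ∑ k, ‖x' k - mirror (x' p - x' q) (x' (Equiv.swap p q k))‖ ^ 2 = 0 :=
    le_antisymm (by linarith) (Finset.sum_nonneg fun _ _ => sq_nonneg _)
  have := (Finset.sum_eq_zero_iff_of_nonneg fun _ _ => sq_nonneg _).1 h0 k (Finset.mem_univ k)
  rw [sq_eq_zero_iff, norm_eq_zero, sub_eq_zero] at this
  exact this.symm

end Compactness

/-! ### Configurations fixed by all symmetrizations -/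

section MirrorSymmetric

variable {ι V : Type*} [DecidableEq ι] [NormedAddCommGroup V] [InnerProductSpace ℝ V]

variable {I : Finset ι} {x : ι → V} {w : ι → ℝ}

theorem IsMirrorSymmetric.compl [Fintype ι] (h : IsMirrorSymmetric I x) : IsMirrorSymmetric Iᶜ x :=
  fun p q hpq => h p q (by simpa [not_iff_not] using hpq)

theorem IsMirrorSymmetric.smul (h : IsMirrorSymmetric I x) {t : ℝ} (ht : t ≠ 0) :
    IsMirrorSymmetric I (t • x) := fun p q hpq k => by
  rw [Pi.smul_apply, Pi.smul_apply, Pi.smul_apply, Pi.smul_apply, ← smul_sub, mirror_smul ht,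
    map_smul, h p q hpq]

theorem IsMirrorSymmetric.inner_sub_eq_zero (h : IsMirrorSymmetric I x) {p q k : ι}
    (hpq : p ∈ I ↔ q ∈ I) (hp : k ≠ p) (hq : k ≠ q) : inner ℝ (x p - x q) (x k) = 0 := by
  have := h p q hpq k
  rwa [Equiv.swap_apply_of_ne_of_ne hp hq, mirror_eq_self_iff] at this

theorem IsMirrorSymmetric.norm_eq (h : IsMirrorSymmetric I x) {p q : ι} (hpq : p ∈ I ↔ q ∈ I) :
    ‖x p‖ = ‖x q‖ := by
  have := h p q hpq p
  rw [Equiv.swap_apply_left] at this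
  rw [← this, LinearIsometryEquiv.norm_map]

variable [Fintype ι]

/-- The two classes are orthogonal. The inner product between them is a constant, so the common
point of the two convex hulls is orthogonal to a hyperplane through all the points, which can only
be if it is the origin. -/
theorem IsMirrorSymmetric.inner_eq_zero (h : IsMirrorSymmetric I x)
    (hw : IsRadonDependence I x w) (hx : affineSpan ℝ (Set.range x) = ⊤) {i j : ι} (hi : i ∈ I)
    (hj : j ∉ I) : inner ℝ (x i) (x j) = 0 := by
  have hconst : ∀ i' ∈ I, ∀ j' ∉ I, inner ℝ (x i') (x j') = inner ℝ (x i) (x j) := by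
    intro i' hi' j' hj'
    have h1 : inner ℝ (x i' - x i) (x j') = 0 := h.inner_sub_eq_zero (by simp [hi, hi'])
      (fun e => hj' (e ▸ hi')) (fun e => hj' (e ▸ hi))
    have h2 : inner ℝ (x j' - x j) (x i) = 0 := h.inner_sub_eq_zero (by simp [hj, hj'])
      (fun e => hj' (e ▸ hi)) (fun e => hj (e ▸ hi))
    rw [inner_sub_left, sub_eq_zero] at h1 h2
    rw [h1, real_inner_comm, h2, real_inner_comm]
  set c := inner ℝ (x i) (x j) with hc
  set g : V := ∑ i ∈ I, w i • x i with hg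
  have hg' : g = ∑ i ∈ Iᶜ, (-w i) • x i := by
    have := Finset.sum_add_sum_compl I fun i => w i • x i
    rw [hw.sum_smul] at this
    simp only [neg_smul, Finset.sum_neg_distrib]
    exact eq_neg_of_add_eq_zero_left this
  have hgx : ∀ k, inner ℝ g (x k) = c := by
    intro k
    by_cases hk : k ∈ I
    · rw [hg', sum_inner]
      have : ∀ j ∈ Iᶜ, inner ℝ ((-w j) • x j) (x k) = (-w) j * c := fun j hj => by
        rw [real_inner_smul_left, real_inner_comm, hconst k hk j (by simpa using hj), Pi.neg_apply]
      rw [Finset.sum_congr rfl this, ← Finset.sum_mul, hw.compl.sum_mem, one_mul]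
    · rw [hg, sum_inner]
      have : ∀ j ∈ I, inner ℝ (w j • x j) (x k) = w j * c := fun j hj => by
        rw [real_inner_smul_left, hconst j hj k hk]
      rw [Finset.sum_congr rfl this, ← Finset.sum_mul, hw.sum_mem, one_mul]
  -- `inner g` is constant on the affine span of the points, which contains the origin.
  have h0 : (0 : V) ∈ affineSpan ℝ (Set.range x) := by rw [hx]; trivial
  obtain ⟨b, hb1, hb2⟩ := eq_affineCombination_of_mem_affineSpan_of_fintype h0
  rw [Finset.affineCombination_eq_linear_combination _ _ _ hb1] at hb2
  have : inner ℝ g (∑ k, b k • x k) = c := by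
    simp only [inner_sum, inner_smul_right, hgx]
    rw [← Finset.sum_mul, hb1, one_mul]
  rw [← hb2, inner_zero_right] at this
  exact this.symm

theorem IsMirrorSymmetric.sum_eq_zero (h : IsMirrorSymmetric I x)
    (hw : IsRadonDependence I x w) (hx : affineSpan ℝ (Set.range x) = ⊤) : ∑ i ∈ I, x i = 0 := by
  have horth := fun {i j : ι} => h.inner_eq_zero hw hx (i := i) (j := j)
  set v := ∑ i ∈ I, x i with hv
  have hvj : ∀ j ∉ I, inner ℝ v (x j) = 0 := fun j hj => by
    rw [hv, sum_inner]
    exact Finset.sum_eq_zero fun i hi => horth hi hj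
  -- The mirrors of the class `I` fix `v` and permute the points of `I`.
  have hconst : ∀ p ∈ I, ∀ q ∈ I, inner ℝ v (x p) = inner ℝ v (x q) := by
    intro p hp q hq
    have hpq : p ∈ I ↔ q ∈ I := by simp [hp, hq]
    have hmv : mirror (x p - x q) v = v := by
      rw [hv, map_sum]
      refine Finset.sum_equiv (Equiv.swap p q) (fun i => ?_) fun i _ => ?_
      · rcases eq_or_ne i p with rfl | hip
        · simp [hp, hq]
        rcases eq_or_ne i q with rfl | hiq
        · simp [hp, hq]
        · rw [Equiv.swap_apply_of_ne_of_ne hip hiq]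
      · have := h p q hpq (Equiv.swap p q i)
        rwa [Equiv.swap_apply_self] at this
    have hmp : mirror (x p - x q) (x p) = x q := by
      have := h p q hpq q
      rwa [Equiv.swap_apply_right] at this
    rw [← hmp, ← LinearIsometryEquiv.inner_map_map (mirror (x p - x q)) v (x p), hmv]
  have hzero : ∀ p ∈ I, inner ℝ v (x p) = 0 := by
    intro p hp
    have h1 : inner ℝ v (∑ i, w i • x i) = inner ℝ v (x p) := by
      rw [← Finset.sum_add_sum_compl I, inner_add_right, inner_sum, inner_sum]
      have e1 : ∀ i ∈ I, inner ℝ v (w i • x i) = w i * inner ℝ v (x p) := fun i hi => by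
        rw [inner_smul_right, hconst i hi p hp]
      have e2 : ∀ i ∈ Iᶜ, inner ℝ v (w i • x i) = 0 := fun i hi => by
        rw [inner_smul_right, hvj i (by simpa using hi), mul_zero]
      rw [Finset.sum_congr rfl e1, Finset.sum_eq_zero e2, ← Finset.sum_mul, hw.sum_mem]
      ring
    rw [← h1, hw.sum_smul, inner_zero_right]
  have hvv : inner ℝ v v = 0 := by
    conv_lhs => rw [hv, inner_sum]
    exact Finset.sum_eq_zero hzero
  exact inner_self_eq_zero.1 hvv

/-- The points of one class are the vertices of a regular simplex centred at the origin. -/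
theorem IsMirrorSymmetric.exists_regular_simplex [FiniteDimensional ℝ V]
    (h : IsMirrorSymmetric I x) (hw : IsRadonDependence I x w)
    (hcard : Fintype.card ι = Module.finrank ℝ V + 2) (hx : affineSpan ℝ (Set.range x) = ⊤)
    {k : ℕ} (hk : I.card = k + 1) :
    ∃ S : Affine.Simplex ℝ V k, Set.range S.points = x '' I ∧ S.Regular ∧ S.centroid = 0 := by
  let e : Fin (k + 1) ≃ I := (Finset.equivFinOfCardEq hk).symm
  let f : Fin (k + 1) → ι := fun a => e a
  have hf : Function.Injective f := Subtype.val_injective.comp e.injective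
  have hfI : ∀ a, f a ∈ I := fun a => (e a).2
  have hfr : Set.range f = I := by
    rw [show f = Subtype.val ∘ e from rfl, Set.range_comp, e.surjective.range_eq, Set.image_univ]
    simp
  have hind : AffineIndependent ℝ (x ∘ f) := by
    rw [affineIndependent_iff_of_fintype]
    intro c hc hcx
    rw [Finset.weightedVSub_eq_linear_combination _ hc] at hcx
    have hext : ∀ a, Function.extend f c 0 (f a) = c a := fun a => hf.extend_apply _ _ _
    have hext0 : ∀ i, i ∉ Set.range f → Function.extend f c 0 i = 0 := fun i hi => by
      rw [Function.extend_apply' _ _ _ hi]; rfl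
    have s1 : ∑ i, Function.extend f c 0 i = 0 := by
      rw [← hc]
      refine (Finset.sum_of_injOn f hf.injOn (by simp) (fun i _ hi => hext0 i (by simpa using hi))
        fun a _ => (hext a).symm).symm
    have s2 : ∑ i, Function.extend f c 0 i • x i = 0 := by
      rw [← hcx]
      refine (Finset.sum_of_injOn f hf.injOn (by simp) (fun i _ hi => ?_) fun a _ => ?_).symm
      · rw [hext0 i (by simpa using hi), zero_smul]
      · rw [hext, Function.comp_apply]
    obtain ⟨j, hj, hj'⟩ := hw.exists_neg
    obtain ⟨t, ht⟩ := exists_smul_eq_of_dependence hcard hx s1 s2 hw.sum_eq_zero hw.sum_smul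
      (fun h0 => by simp [h0] at hj')
    have ht0 : t = 0 := by
      have := congrFun ht j
      rw [hext0 j (by rw [hfr]; exact hj)] at this
      simpa [hj'.ne] using this.symm
    intro a
    rw [← hext a, ht, ht0, zero_smul, Pi.zero_apply]
  refine ⟨⟨x ∘ f, hind⟩, by rw [Set.range_comp, hfr], fun σ => ?_, ?_⟩
  · induction σ using Equiv.Perm.swap_induction_on with
    | one => exact ⟨IsometryEquiv.refl V, rfl⟩
    | swap_mul σ a b hab ih =>
      obtain ⟨y, hy⟩ := ih
      refine ⟨y.trans (mirror (x (f a) - x (f b))).toIsometryEquiv, ?_⟩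
      ext m
      have h1 := congrFun hy m
      have h2 := h (f a) (f b) (by simp [hfI]) (Equiv.swap (f a) (f b) (f (σ m)))
      rw [Equiv.swap_apply_self, hf.swap_apply] at h2
      simp only [Function.comp_apply, Equiv.Perm.mul_apply, IsometryEquiv.trans_apply] at h1 ⊢
      rw [← h1, ← h2]
      rfl
  · rw [Affine.Simplex.centroid_eq_affineCombination,
      Finset.affineCombination_eq_linear_combination _ _ _
        (Finset.sum_centroidWeights_eq_one_of_nonempty ℝ _ Finset.univ_nonempty)]
    simp only [Finset.centroidWeights_apply, ← Finset.smul_sum]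
    have : ∑ a, (x ∘ f) a = ∑ i ∈ I, x i := by
      refine Finset.sum_of_injOn f hf.injOn (fun a _ => hfI a) (fun i hi hi' => ?_) fun _ _ => rfl
      exact absurd (by rw [Finset.coe_univ, Set.image_univ, hfr]; exact hi) hi'
    rw [this, h.sum_eq_zero hw hx, smul_zero]

end MirrorSymmetric

theorem IsMirrorSymmetric.isOrthogonalRegularHull {d : ℕ} {ι : Type*} [Fintype ι] [DecidableEq ι]
    {I : Finset ι} {x : ι → EuclideanSpace ℝ (Fin d)} {w : ι → ℝ} (h : IsMirrorSymmetric I x)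
    (hw : IsRadonDependence I x w) (hcard : Fintype.card ι = d + 2)
    (hx : affineSpan ℝ (Set.range x) = ⊤) (hI : 2 ≤ I.card) (hI' : 2 ≤ Iᶜ.card) :
    IsOrthogonalRegularHull (convexHull ℝ (Set.range x)) := by
  have hcard' : Fintype.card ι = Module.finrank ℝ (EuclideanSpace ℝ (Fin d)) + 2 := by
    rw [hcard, finrank_euclideanSpace_fin]
  obtain ⟨S₁, hS₁, hr₁, hc₁⟩ := h.exists_regular_simplex hw hcard' hx
    (k := I.card - 1) (by omega)
  obtain ⟨S₂, hS₂, hr₂, hc₂⟩ := h.compl.exists_regular_simplex hw.compl hcard' hx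
    (k := Iᶜ.card - 1) (by omega)
  have hU : x '' I ∪ x '' ((Iᶜ : Finset ι) : Set ι) = Set.range x := by
    rw [← Set.image_union, Finset.coe_compl, Set.union_compl_self, Set.image_univ]
  refine ⟨_, _, S₁, S₂, by omega, by omega, hr₁, hr₂, hc₁, hc₂, ?_, ?_⟩
  · rw [hS₁, hS₂]
    have hle : Submodule.span ℝ (x '' ((Iᶜ : Finset ι) : Set ι)) ≤
        (Submodule.span ℝ (x '' (I : Set ι)))ᗮ := by
      rw [Submodule.span_le]
      rintro _ ⟨j, hj, rfl⟩
      rw [SetLike.mem_coe, Submodule.mem_orthogonal]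
      intro u hu
      induction hu using Submodule.span_induction with
      | mem u hu =>
        obtain ⟨i, hi, rfl⟩ := hu
        exact h.inner_eq_zero hw hx hi (by simpa using hj)
      | zero => exact inner_zero_left _
      | add u v _ _ hu hv => rw [inner_add_left, hu, hv, add_zero]
      | smul t u _ hu => rw [inner_smul_left, hu, mul_zero]
    have htop : Submodule.span ℝ (x '' (I : Set ι)) ⊔
        Submodule.span ℝ (x '' ((Iᶜ : Finset ι) : Set ι)) = ⊤ := by
      rw [← Submodule.span_union, hU, eq_top_iff]
      intro v _
      have : v ∈ affineSpan ℝ (Set.range x) := by rw [hx]; trivial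
      exact affineSpan_subset_span this
    refine le_antisymm hle fun v hv => ?_
    have : v ∈ Submodule.span ℝ (x '' (I : Set ι)) ⊔
        Submodule.span ℝ (x '' ((Iᶜ : Finset ι) : Set ι)) := by rw [htop]; trivial
    obtain ⟨a, ha, b, hb, rfl⟩ := Submodule.mem_sup.1 this
    have h1 := (Submodule.mem_orthogonal _ _).1 hv a ha
    have h2 := (Submodule.mem_orthogonal _ _).1 (hle hb) a ha
    rw [inner_add_right, h2, add_zero] at h1
    rw [inner_self_eq_zero.1 h1, zero_add]
    exact hb
  · rw [← S₁.convexHull_eq_closedInterior, ← S₂.convexHull_eq_closedInterior, hS₁, hS₂,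
      convexHull_convexHull_union_left, convexHull_convexHull_union_right, hU]

/-! ### Radial integrals -/

section RadialIntegral

theorem comp_clamp_norm {V : Type*} [NormedAddCommGroup V] {A : Set V} {M : ℝ}
    (ρ : ℝ → ℝ) (hA : A ⊆ Metric.closedBall 0 M) :
    Set.EqOn (fun x => ρ (max 0 (min ‖x‖ M))) (fun x => ρ ‖x‖) A := fun x hx => by
  simp [min_eq_left (mem_closedBall_zero_iff.1 (hA hx))]

variable {V : Type*} [NormedAddCommGroup V] [InnerProductSpace ℝ V] [FiniteDimensional ℝ V]
  [MeasurableSpace V] [BorelSpace V] {μ : Measure V} [μ.IsAddHaarMeasure] {A B : Set V} {M : ℝ}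

theorem measure_norm_preimage_lowerSet_le [Nontrivial V]
    (hAM : A ⊆ Metric.closedBall 0 M)
    (h : ∀ t : ℝ, μ (A ∩ Metric.closedBall 0 t) ≤ μ (B ∩ Metric.closedBall 0 t))
    {T : Set ℝ} (hT : IsLowerSet T) : μ ({a | ‖a‖ ∈ T} ∩ A) ≤ μ ({a | ‖a‖ ∈ T} ∩ B) := by
  by_cases hM : M ∈ T
  · calc μ ({a | ‖a‖ ∈ T} ∩ A) ≤ μ (A ∩ Metric.closedBall 0 M) :=
          measure_mono fun a ha => ⟨ha.2, hAM ha.2⟩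
      _ ≤ μ (B ∩ Metric.closedBall 0 M) := h M
      _ ≤ μ ({a | ‖a‖ ∈ T} ∩ B) :=
          measure_mono fun a ha => ⟨hT (mem_closedBall_zero_iff.1 ha.2) hM, ha.1⟩
  rcases T.eq_empty_or_nonempty with rfl | hne
  · simp
  have hbdd : BddAbove T := ⟨M, fun τ hτ => le_of_not_gt fun hlt => hM (hT hlt.le hτ)⟩
  -- The level set is a ball about the origin, up to a sphere, which is a null set.
  calc μ ({a | ‖a‖ ∈ T} ∩ A) ≤ μ (A ∩ Metric.closedBall 0 (sSup T)) :=
        measure_mono fun a ha => ⟨ha.2, mem_closedBall_zero_iff.2 (le_csSup hbdd ha.1)⟩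
    _ ≤ μ (B ∩ Metric.closedBall 0 (sSup T)) := h _
    _ ≤ μ (({a | ‖a‖ ∈ T} ∩ B) ∪ Metric.sphere 0 (sSup T)) := by
        refine measure_mono fun a ha => ?_
        rcases (mem_closedBall_zero_iff.1 ha.2).lt_or_eq with hlt | heq
        · obtain ⟨τ, hτ, hlt'⟩ := exists_lt_of_lt_csSup hne hlt
          exact Or.inl ⟨hT hlt'.le hτ, ha.1⟩
        · exact Or.inr (mem_sphere_zero_iff_norm.2 heq)
    _ ≤ μ ({a | ‖a‖ ∈ T} ∩ B) + μ (Metric.sphere 0 (sSup T)) := measure_union_le _ _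
    _ = μ ({a | ‖a‖ ∈ T} ∩ B) := by rw [Measure.addHaar_sphere, add_zero]

theorem integrableOn_comp_norm_of_antitone
    (hA : A ⊆ Metric.closedBall 0 M) {ρ : ℝ → ℝ} (hρ : Antitone ρ) (h0 : ∀ τ, 0 ≤ ρ τ) :
    IntegrableOn (fun x => ρ ‖x‖) A μ := by
  refine Measure.integrableOn_of_bounded (M := ρ 0)
    ((measure_mono hA).trans_lt measure_closedBall_lt_top).ne
    (hρ.measurable.comp measurable_norm).aestronglyMeasurable
    (Filter.Eventually.of_forall fun x => ?_)
  rw [Real.norm_of_nonneg (h0 _)]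
  exact hρ (norm_nonneg x)

/-- Layer cake: the superlevel sets of a decreasing radial function are balls about the origin. -/
theorem setIntegral_comp_norm_le_of_antitone [Nontrivial V] (hAm : MeasurableSet A)
    (hBm : MeasurableSet B) (hAM : A ⊆ Metric.closedBall 0 M) (hBM : B ⊆ Metric.closedBall 0 M)
    (h : ∀ t : ℝ, μ (A ∩ Metric.closedBall 0 t) ≤ μ (B ∩ Metric.closedBall 0 t))
    {ρ : ℝ → ℝ} (hρ : Antitone ρ) (h0 : ∀ τ, 0 ≤ ρ τ) :
    ∫ x in A, ρ ‖x‖ ∂μ ≤ ∫ x in B, ρ ‖x‖ ∂μ := by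
  have hm : Measurable fun x : V => ρ ‖x‖ := hρ.measurable.comp measurable_norm
  have hnn : ∀ ν : Measure V, 0 ≤ᵐ[ν] fun x : V => ρ ‖x‖ := fun ν =>
    Filter.Eventually.of_forall fun x => h0 _
  rw [integral_eq_lintegral_of_nonneg_ae (hnn _) hm.aestronglyMeasurable,
    integral_eq_lintegral_of_nonneg_ae (hnn _) hm.aestronglyMeasurable]
  refine ENNReal.toReal_mono
    (integrableOn_comp_norm_of_antitone hBM hρ h0).lintegral_lt_top.ne ?_
  rw [lintegral_eq_lintegral_meas_lt _ (hnn _) hm.aemeasurable,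
    lintegral_eq_lintegral_meas_lt _ (hnn _) hm.aemeasurable]
  refine lintegral_mono fun s => ?_
  rw [Measure.restrict_apply' hAm, Measure.restrict_apply' hBm]
  exact measure_norm_preimage_lowerSet_le hAM h (T := {τ | s < ρ τ})
    fun τ τ' hle hτ => lt_of_lt_of_le hτ (hρ hle)

theorem antitone_comp_clamp {ρ : ℝ → ℝ} (hM : 0 ≤ M) (hρ : AntitoneOn ρ (Set.Icc 0 M)) :
    Antitone fun τ => ρ (max 0 (min τ M)) := fun _ _ hab =>
  hρ ⟨le_max_left _ _, max_le hM (min_le_right _ _)⟩ ⟨le_max_left _ _, max_le hM (min_le_right _ _)⟩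
    (max_le_max le_rfl (min_le_min hab le_rfl))

theorem integrableOn_comp_norm_of_antitoneOn (hAm : MeasurableSet A)
    (hA : A ⊆ Metric.closedBall 0 M) {ρ : ℝ → ℝ} (hM : 0 ≤ M)
    (hρ : AntitoneOn ρ (Set.Icc 0 M)) (h0 : ∀ τ ∈ Set.Icc 0 M, 0 ≤ ρ τ) :
    IntegrableOn (fun x => ρ ‖x‖) A μ :=
  (integrableOn_comp_norm_of_antitone hA (antitone_comp_clamp hM hρ)
    fun _ => h0 _ ⟨le_max_left _ _, max_le hM (min_le_right _ _)⟩).congr_fun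
    (comp_clamp_norm ρ hA) hAm

theorem setIntegral_comp_norm_le_of_antitoneOn [Nontrivial V] (hAm : MeasurableSet A)
    (hBm : MeasurableSet B) (hAM : A ⊆ Metric.closedBall 0 M) (hBM : B ⊆ Metric.closedBall 0 M)
    (h : ∀ t : ℝ, μ (A ∩ Metric.closedBall 0 t) ≤ μ (B ∩ Metric.closedBall 0 t))
    {ρ : ℝ → ℝ} (hM : 0 ≤ M) (hρ : AntitoneOn ρ (Set.Icc 0 M))
    (h0 : ∀ τ ∈ Set.Icc 0 M, 0 ≤ ρ τ) : ∫ x in A, ρ ‖x‖ ∂μ ≤ ∫ x in B, ρ ‖x‖ ∂μ := by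
  rw [← setIntegral_congr_fun hAm (comp_clamp_norm ρ hAM),
    ← setIntegral_congr_fun hBm (comp_clamp_norm ρ hBM)]
  exact setIntegral_comp_norm_le_of_antitone hAm hBm hAM hBM h (antitone_comp_clamp hM hρ)
    fun _ => h0 _ ⟨le_max_left _ _, max_le hM (min_le_right _ _)⟩

theorem integrableOn_comp_norm_of_monotoneOn (hAm : MeasurableSet A)
    (hA : A ⊆ Metric.closedBall 0 M) {ρ : ℝ → ℝ} (hM : 0 ≤ M)
    (hρ : MonotoneOn ρ (Set.Icc 0 M)) : IntegrableOn (fun x => ρ ‖x‖) A μ := by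
  have h := integrableOn_comp_norm_of_antitoneOn (μ := μ) (ρ := fun τ => ρ M - ρ τ) hAm hA hM
    (fun a ha b hb hab => sub_le_sub_left (hρ ha hb hab) _)
    fun τ hτ => sub_nonneg.2 (hρ hτ ⟨hM, le_rfl⟩ hτ.2)
  have hc : IntegrableOn (fun _ : V => ρ M) A μ :=
    integrableOn_const ((measure_mono hA).trans_lt measure_closedBall_lt_top).ne
  exact (hc.sub h).congr_fun (fun x _ => by simp) hAm

/-- An increasing `ρ` is a constant minus a decreasing function, and the two sets have the same
measure. -/
theorem setIntegral_comp_norm_le_of_monotoneOn [Nontrivial V] (hAm : MeasurableSet A)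
    (hBm : MeasurableSet B) (hAM : A ⊆ Metric.closedBall 0 M) (hBM : B ⊆ Metric.closedBall 0 M)
    (h : ∀ t : ℝ, μ (A ∩ Metric.closedBall 0 t) ≤ μ (B ∩ Metric.closedBall 0 t))
    (hBA : μ B ≤ μ A) {ρ : ℝ → ℝ} (hM : 0 ≤ M) (hρ : MonotoneOn ρ (Set.Icc 0 M)) :
    ∫ x in B, ρ ‖x‖ ∂μ ≤ ∫ x in A, ρ ‖x‖ ∂μ := by
  have hAB : μ A = μ B := by
    refine le_antisymm ?_ hBA
    have := h M
    rwa [Set.inter_eq_left.2 hAM, Set.inter_eq_left.2 hBM] at this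
  have key := setIntegral_comp_norm_le_of_antitoneOn (ρ := fun τ => ρ M - ρ τ) hAm hBm hAM hBM h hM
    (fun a ha b hb hab => sub_le_sub_left (hρ ha hb hab) _)
    fun τ hτ => sub_nonneg.2 (hρ hτ ⟨hM, le_rfl⟩ hτ.2)
  have hc : ∀ S : Set V, S ⊆ Metric.closedBall 0 M → IntegrableOn (fun _ : V => ρ M) S μ :=
    fun S hS => integrableOn_const ((measure_mono hS).trans_lt measure_closedBall_lt_top).ne
  rw [integral_sub (hc A hAM) (integrableOn_comp_norm_of_monotoneOn hAm hAM hM hρ),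
    integral_sub (hc B hBM) (integrableOn_comp_norm_of_monotoneOn hBm hBM hM hρ),
    setIntegral_const, setIntegral_const, measureReal_def, measureReal_def, hAB] at key
  linarith

end RadialIntegral

/-! ### Circumradius and inradius -/

section Radii

theorem IsRadonDependence.smul {ι V : Type*} [Fintype ι] [AddCommGroup V] [Module ℝ V]
    {I : Finset ι} {x : ι → V} {w : ι → ℝ} (h : IsRadonDependence I x w) (t : ℝ) :
    IsRadonDependence I (t • x) w where
  nonneg := h.nonneg
  nonpos := h.nonpos
  sum_mem := h.sum_mem
  sum_eq_zero := h.sum_eq_zero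
  sum_smul := by
    simp only [Pi.smul_apply, smul_comm _ t, ← Finset.smul_sum, h.sum_smul, smul_zero]

theorem range_smul_eq {ι V : Type*} [AddCommGroup V] [Module ℝ V] (t : ℝ) (x : ι → V) :
    Set.range (t • x) = (fun v => t • v) '' Set.range x := by
  rw [← Set.range_comp]; rfl

theorem affineSpan_range_smul {ι V : Type*} [AddCommGroup V] [Module ℝ V] {x : ι → V}
    (hx : affineSpan ℝ (Set.range x) = ⊤) {t : ℝ} (ht : t ≠ 0) :
    affineSpan ℝ (Set.range (t • x)) = ⊤ := by
  let e : V ≃ₗ[ℝ] V := LinearEquiv.smulOfNeZero ℝ V t ht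
  have h := AffineEquiv.span_eq_top_iff (s := Set.range x) e.toAffineEquiv
  rw [range_smul_eq]
  exact h.1 hx

theorem convexHull_range_smul {ι V : Type*} [AddCommGroup V] [Module ℝ V] (t : ℝ) (x : ι → V) :
    convexHull ℝ (Set.range (t • x)) = (fun v => t • v) '' convexHull ℝ (Set.range x) := by
  rw [range_smul_eq]
  exact ((LinearMap.lsmul ℝ V t).image_convexHull _).symm

variable {ι V : Type*} [Fintype ι] [DecidableEq ι] [NormedAddCommGroup V] [InnerProductSpace ℝ V]
  {I : Finset ι} {x : ι → V} {w : ι → ℝ}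

theorem IsMirrorSymmetric.zero_mem_convexHull (h : IsMirrorSymmetric I x)
    (hw : IsRadonDependence I x w) (hx : affineSpan ℝ (Set.range x) = ⊤) (hI : I.Nonempty) :
    (0 : V) ∈ convexHull ℝ (Set.range x) := by
  have hIpos : (0 : ℝ) < I.card := by exact_mod_cast hI.card_pos
  have := (convex_convexHull ℝ (Set.range x)).sum_mem (t := I) (w := fun _ => (I.card : ℝ)⁻¹)
    (z := x) (fun _ _ => (inv_pos.2 hIpos).le) (by simp [hIpos.ne'])
    fun i _ => subset_convexHull ℝ _ ⟨i, rfl⟩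
  rwa [← Finset.smul_sum, h.sum_eq_zero hw hx, smul_zero] at this

/-- A ball containing all the points has radius at least `‖x k‖` for every `k`, wherever its
centre is: the points of the class of `k` have this norm and centroid `0`. -/
theorem IsMirrorSymmetric.norm_le_of_subset_closedBall (h : IsMirrorSymmetric I x)
    (hw : IsRadonDependence I x w) (hx : affineSpan ℝ (Set.range x) = ⊤) {c : V} {r : ℝ}
    (hc : ∀ k, ‖x k - c‖ ≤ r) (k : ι) : ‖x k‖ ≤ r := by
  wlog hk : k ∈ I generalizing I w
  · exact this h.compl hw.compl (by simpa using hk)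
  have hr : 0 ≤ r := (norm_nonneg _).trans (hc k)
  have h1 : ∑ i ∈ I, ‖x i - c‖ ^ 2 = I.card * (‖x k‖ ^ 2 + ‖c‖ ^ 2) := by
    have : ∀ i ∈ I, ‖x i - c‖ ^ 2 = (‖x k‖ ^ 2 + ‖c‖ ^ 2) - 2 * inner ℝ (x i) c := fun i hi => by
      rw [norm_sub_sq_real, h.norm_eq (p := i) (q := k) (by simp [hi, hk])]; ring
    rw [Finset.sum_congr rfl this, Finset.sum_sub_distrib, ← Finset.mul_sum, ← sum_inner,
      h.sum_eq_zero hw hx, inner_zero_left, Finset.sum_const, nsmul_eq_mul]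
    ring
  have h2 : ∑ i ∈ I, ‖x i - c‖ ^ 2 ≤ I.card * r ^ 2 := by
    rw [← nsmul_eq_mul]
    exact Finset.sum_le_card_nsmul _ _ _ fun i _ => pow_le_pow_left₀ (norm_nonneg _) (hc i) 2
  have h3 : (0 : ℝ) < I.card := by exact_mod_cast Finset.card_pos.2 ⟨k, hk⟩
  rw [h1] at h2
  have h4 := le_of_mul_le_mul_left h2 h3
  exact abs_le_of_sq_le_sq' (by nlinarith [sq_nonneg ‖c‖]) hr |>.2

theorem convexHull_range_subset_closedBall_iff {ι V : Type*} [NormedAddCommGroup V]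
    [NormedSpace ℝ V] {x : ι → V} {c : V} {r : ℝ} :
    convexHull ℝ (Set.range x) ⊆ Metric.closedBall c r ↔ ∀ k, ‖x k - c‖ ≤ r := by
  rw [(convex_closedBall c r).convexHull_subset_iff, Set.range_subset_iff]
  simp [dist_eq_norm]

variable {d : ℕ}

theorem IsMirrorSymmetric.circumradius_eq {x : ι → EuclideanSpace ℝ (Fin d)}
    (h : IsMirrorSymmetric I x) (hw : IsRadonDependence I x w)
    (hx : affineSpan ℝ (Set.range x) = ⊤) {k : ι} (hk : ∀ j, ‖x j‖ ≤ ‖x k‖) :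
    circumradius (convexHull ℝ (Set.range x)) = ‖x k‖ := by
  refine IsLeast.csInf_eq ⟨⟨norm_nonneg _, 0, ?_⟩, ?_⟩
  · rw [convexHull_range_subset_closedBall_iff]; simpa using hk
  · rintro r ⟨-, c, hc⟩
    exact h.norm_le_of_subset_closedBall hw hx (convexHull_range_subset_closedBall_iff.1 hc) k

/-- A mirror symmetric configuration scaled to a prescribed circumradius. -/
theorem IsMirrorSymmetric.exists_circumradius_eq {x : ι → EuclideanSpace ℝ (Fin d)}
    (h : IsMirrorSymmetric I x) (hw : IsRadonDependence I x w) (hcard : Fintype.card ι = d + 2)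
    (hx : affineSpan ℝ (Set.range x) = ⊤) (hI : 2 ≤ I.card) (hI' : 2 ≤ Iᶜ.card) {R : ℝ}
    (hR : 0 < R) : ∃ Q : Set (EuclideanSpace ℝ (Fin d)), IsOrthogonalRegularHull Q ∧
      MeasurableSet Q ∧ Q ⊆ Metric.closedBall 0 R ∧ circumradius Q = R ∧
      ((∀ k, ‖x k‖ ≤ R) → convexHull ℝ (Set.range x) ⊆ Q) := by
  obtain ⟨p, hp, q, hq, hpq⟩ := Finset.one_lt_card.1 hI
  have hne : x p ≠ x q := hw.ne_of_mem (by rw [hcard, finrank_euclideanSpace_fin]) hx hp hq hpq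
  obtain ⟨k, -, hk⟩ := Finset.exists_max_image Finset.univ (fun k => ‖x k‖) ⟨p, Finset.mem_univ p⟩
  replace hk : ∀ j, ‖x j‖ ≤ ‖x k‖ := fun j => hk j (Finset.mem_univ j)
  have hN : 0 < ‖x k‖ := by
    by_contra! hN
    have h0 : ∀ j, x j = 0 := fun j => norm_le_zero_iff.1 ((hk j).trans hN)
    exact hne (by rw [h0, h0])
  set t := R / ‖x k‖ with ht
  have ht0 : 0 < t := div_pos hR hN
  have hn : ∀ j, ‖(t • x) j‖ = t * ‖x j‖ := fun j => by
    rw [Pi.smul_apply, norm_smul, Real.norm_of_nonneg ht0.le]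
  have hnk : ‖(t • x) k‖ = R := by rw [hn, ht, div_mul_cancel₀ _ hN.ne']
  have hle : ∀ j, ‖(t • x) j‖ ≤ ‖(t • x) k‖ := fun j => by
    rw [hn, hn]; exact mul_le_mul_of_nonneg_left (hk j) ht0.le
  have h' := h.smul ht0.ne'
  have hx' := affineSpan_range_smul hx ht0.ne'
  have hzero : (0 : EuclideanSpace ℝ (Fin d)) ∈ convexHull ℝ (Set.range (t • x)) :=
    h'.zero_mem_convexHull (hw.smul t) hx' ⟨p, hp⟩
  refine ⟨convexHull ℝ (Set.range (t • x)),
    h'.isOrthogonalRegularHull (hw.smul t) hcard hx' hI hI',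
    ((Set.finite_range _).isClosed_convexHull ℝ).measurableSet, ?_, ?_, fun hxR => ?_⟩
  · rw [convexHull_range_subset_closedBall_iff]
    simpa only [sub_zero, hnk] using hle
  · rw [h'.circumradius_eq (hw.smul t) hx' hle, hnk]
  · have ht1 : 1 ≤ t := (one_le_div hN).2 (hxR k)
    refine convexHull_min ?_ (convex_convexHull ℝ _)
    rintro _ ⟨j, rfl⟩
    have := (convex_convexHull ℝ (Set.range (t • x))) hzero (subset_convexHull ℝ _ ⟨j, rfl⟩)
      (a := 1 - t⁻¹) (b := t⁻¹) (sub_nonneg.2 (inv_le_one_of_one_le₀ ht1)) (inv_pos.2 ht0).le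
      (by ring)
    simpa [smul_smul, ht0.ne'] using this

theorem inradius_smul {t : ℝ} (ht : 0 < t) (A : Set (EuclideanSpace ℝ (Fin d))) :
    inradius ((fun v => t • v) '' A) = t * inradius A := by
  have hb : ∀ (c : EuclideanSpace ℝ (Fin d)) (r : ℝ),
      Metric.closedBall (t • c) (t * r) ⊆ (fun v => t • v) '' A ↔ Metric.closedBall c r ⊆ A := by
    intro c r
    have e : (fun v => t • v) '' Metric.closedBall c r = Metric.closedBall (t • c) (t * r) := by
      have := smul_closedBall' ht.ne' c r
      rw [Real.norm_of_nonneg ht.le] at this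
      exact this
    rw [← e, Set.image_subset_image_iff (smul_right_injective _ ht.ne')]
  unfold inradius
  rw [← smul_eq_mul, ← Real.sSup_smul_of_nonneg ht.le]
  congr 1
  ext r
  rw [Set.mem_smul_set]
  constructor
  · rintro ⟨hr, c, hc⟩
    refine ⟨t⁻¹ * r, ⟨by positivity, t⁻¹ • c, ?_⟩, by simp [ht.ne']⟩
    rw [← hb]
    simpa [smul_smul, ← mul_assoc, ht.ne'] using hc
  · rintro ⟨r, ⟨hr, c, hc⟩, rfl⟩
    exact ⟨mul_nonneg ht.le hr, t • c, (hb c r).2 hc⟩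

theorem bddAbove_inscribed_radii [Nontrivial V] {A : Set V} {M : ℝ}
    (hA : A ⊆ Metric.closedBall 0 M) :
    BddAbove {r : ℝ | 0 ≤ r ∧ ∃ c, Metric.closedBall c r ⊆ A} := by
  refine ⟨M, ?_⟩
  rintro r ⟨hr, c, hc⟩
  obtain ⟨u, hu⟩ := exists_norm_eq V hr
  have h1 := mem_closedBall_zero_iff.1 (hA (hc (by simp [hu] : c + u ∈ Metric.closedBall c r)))
  have h2 := mem_closedBall_zero_iff.1 (hA (hc (by simp [hu] : c - u ∈ Metric.closedBall c r)))
  have h3 := norm_sub_le (c + u) (c - u)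
  have h4 : c + u - (c - u) = (2 : ℝ) • u := by module
  rw [h4, norm_smul, hu] at h3
  norm_num at h3
  linarith

end Radii

/-! ### Polytopes with `d + 2` vertices -/

section Vertices

variable {d : ℕ}

/-- Neither class of a Radon partition of points in convex position is a single point. -/
theorem IsRadonDependence.two_le_card {ι V : Type*} [Fintype ι] [DecidableEq ι] [AddCommGroup V]
    [Module ℝ V] {I : Finset ι} {x : ι → V} {w : ι → ℝ} (h : IsRadonDependence I x w)
    (hinj : Function.Injective x)
    (hext : ∀ i, x i ∈ (convexHull ℝ (Set.range x)).extremePoints ℝ) : 2 ≤ I.card := by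
  by_contra! hlt
  have h1 : I.card ≠ 0 := fun h0 => by
    have := h.sum_mem
    rw [Finset.card_eq_zero.1 h0, Finset.sum_empty] at this
    exact zero_ne_one this
  obtain ⟨i, rfl⟩ := Finset.card_eq_one.1 (by omega : I.card = 1)
  have hi : x i = ∑ j ∈ ({i} : Finset ι)ᶜ, (-w) j • x j := by
    have h2 := Finset.sum_add_sum_compl {i} fun j => w j • x j
    have h3 := h.sum_mem
    rw [Finset.sum_singleton] at h2 h3
    rw [h.sum_smul, h3, one_smul] at h2
    simp only [Pi.neg_apply, neg_smul, Finset.sum_neg_distrib]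
    exact eq_neg_of_add_eq_zero_left h2
  set C := convexHull ℝ (x '' {i}ᶜ) with hC
  have hiC : x i ∈ C := by
    rw [hi]
    exact (convex_convexHull ℝ _).sum_mem h.compl.nonneg h.compl.sum_mem fun j hj =>
      subset_convexHull ℝ _ ⟨j, by simpa using hj, rfl⟩
  have hle : convexHull ℝ (Set.range x) = C := by
    refine (convexHull_min ?_ (convex_convexHull ℝ _)).antisymm
      (convexHull_mono (Set.image_subset_range _ _))
    rintro _ ⟨j, rfl⟩
    rcases eq_or_ne j i with rfl | hj
    · exact hiC
    · exact subset_convexHull ℝ _ ⟨j, hj, rfl⟩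
  obtain ⟨j, hj, hji⟩ := extremePoints_convexHull_subset (hle ▸ hext i)
  exact hj (hinj hji)

theorem exists_isRadonDependence {ι V : Type*} [Fintype ι] [AddCommGroup V]
    [Module ℝ V] [FiniteDimensional ℝ V] (x : ι → V)
    (hcard : Fintype.card ι = Module.finrank ℝ V + 2) : ∃ I w, IsRadonDependence I x w := by
  classical
  have hdep : ¬ AffineIndependent ℝ x := fun hi => by
    have := hi.card_le_finrank_succ
    have := Submodule.finrank_le (vectorSpan ℝ (Set.range x))
    omega
  rw [affineIndependent_iff_of_fintype] at hdep
  push Not at hdep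
  obtain ⟨w, hw, hwx, i, hi⟩ := hdep
  rw [Finset.weightedVSub_eq_linear_combination _ hw] at hwx
  set I := Finset.univ.filter fun i => 0 ≤ w i with hI
  have hs : 0 < ∑ i ∈ I, w i := by
    obtain ⟨j, hj, hj'⟩ := Finset.exists_pos_of_sum_zero_of_exists_nonzero w hw
      ⟨i, Finset.mem_univ i, hi⟩
    exact Finset.sum_pos' (fun k hk => (Finset.mem_filter.1 hk).2)
      ⟨j, Finset.mem_filter.2 ⟨hj, hj'.le⟩, hj'⟩
  refine ⟨I, (∑ i ∈ I, w i)⁻¹ • w, fun k hk => ?_, fun k hk => ?_, ?_, ?_, ?_⟩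
  · exact mul_nonneg (inv_pos.2 hs).le (Finset.mem_filter.1 hk).2
  · refine mul_nonpos_of_nonneg_of_nonpos (inv_pos.2 hs).le ?_
    by_contra! hlt
    exact hk (Finset.mem_filter.2 ⟨Finset.mem_univ k, hlt.le⟩)
  · simp only [Pi.smul_apply, smul_eq_mul, ← Finset.mul_sum]
    exact inv_mul_cancel₀ hs.ne'
  · simp only [Pi.smul_apply, ← Finset.smul_sum, hw, smul_zero]
  · simp only [Pi.smul_apply, smul_assoc, ← Finset.smul_sum, hwx, smul_zero]

theorem IsConvexPolytope.exists_vertices {P : Set (EuclideanSpace ℝ (Fin d))}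
    (hP : IsConvexPolytope P) {n : ℕ} (hn : n ≠ 0) (hV : (vertexSet P).ncard = n) :
    ∃ x : Fin n → EuclideanSpace ℝ (Fin d), Function.Injective x ∧
      P = convexHull ℝ (Set.range x) ∧ ∀ i, x i ∈ P.extremePoints ℝ := by
  have hfin : (vertexSet P).Finite := Set.finite_of_ncard_ne_zero (by omega)
  have hPV : P = convexHull ℝ (vertexSet P) := by
    obtain ⟨s, rfl⟩ := hP
    have h := closure_convexHull_extremePoints (s.finite_toSet.isCompact_convexHull ℝ)
      (convex_convexHull ℝ (s : Set (EuclideanSpace ℝ (Fin d))))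
    exact (h.symm.trans (hfin.isClosed_convexHull ℝ).closure_eq)
  have : Finite (vertexSet P) := hfin
  let e : vertexSet P ≃ Fin n := Finite.equivFinOfCardEq (by rw [Nat.card_coe_set_eq, hV])
  have hr : Set.range (fun i => (e.symm i : EuclideanSpace ℝ (Fin d))) = vertexSet P := by
    change Set.range (Subtype.val ∘ e.symm) = _
    rw [Set.range_comp, e.symm.surjective.range_eq, Set.image_univ, Subtype.range_coe]
  exact ⟨fun i => e.symm i, Subtype.val_injective.comp e.symm.injective, by rw [hr]; exact hPV,
    fun i => (e.symm i).2⟩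

/-- Some configuration which is not contained in a hyperplane and has both Radon classes of size at
least `2`: the basis vectors together with `0` and the sum of two basis vectors. -/
theorem exists_nondegenerate_configuration (hd : 2 ≤ d) :
    ∃ (x : Fin 2 ⊕ Fin d → EuclideanSpace ℝ (Fin d)) (I : Finset (Fin 2 ⊕ Fin d))
      (w : Fin 2 ⊕ Fin d → ℝ), IsRadonDependence I x w ∧ affineSpan ℝ (Set.range x) = ⊤ ∧
        2 ≤ I.card ∧ 2 ≤ Iᶜ.card := by
  let b := EuclideanSpace.basisFun (Fin d) ℝ
  let i₀ : Fin d := ⟨0, by omega⟩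
  let i₁ : Fin d := ⟨1, by omega⟩
  have hne : i₀ ≠ i₁ := by simp [i₀, i₁]
  let x : Fin 2 ⊕ Fin d → EuclideanSpace ℝ (Fin d) := Sum.elim ![0, b i₀ + b i₁] b
  let I : Finset (Fin 2 ⊕ Fin d) := {Sum.inl 0, Sum.inl 1}
  have hI : I.card = 2 := Finset.card_pair (by simp)
  refine ⟨x, I, Sum.elim (fun _ => 1 / 2) (-(Pi.single i₀ (1 / 2) + Pi.single i₁ (1 / 2))),
    ⟨?_, ?_, ?_, ?_, ?_⟩, ?_, hI.ge, ?_⟩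
  · intro i hi
    rcases i with i | i
    · norm_num
    · simp [I] at hi
  · intro i hi
    rcases i with i | i
    · fin_cases i <;> simp [I] at hi
    · have h0 : 0 ≤ (Pi.single i₀ (1 / 2) : Fin d → ℝ) i := by
        rw [Pi.single_apply]; split_ifs <;> norm_num
      have h1 : 0 ≤ (Pi.single i₁ (1 / 2) : Fin d → ℝ) i := by
        rw [Pi.single_apply]; split_ifs <;> norm_num
      simp only [Sum.elim_inr, Pi.neg_apply, Pi.add_apply]
      linarith
  · rw [Finset.sum_pair (by simp)]; norm_num
  · simp [Finset.sum_add_distrib]; norm_num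
  · simp only [Fintype.sum_sum_type, Sum.elim_inl, Sum.elim_inr, x, Fin.sum_univ_two,
      Pi.neg_apply, Pi.add_apply, neg_smul, add_smul, Finset.sum_neg_distrib,
      Finset.sum_add_distrib]
    rw [Finset.sum_eq_single i₀, Finset.sum_eq_single i₁]
    · simp
    all_goals simp +contextual
  · have h0 : (0 : EuclideanSpace ℝ (Fin d)) ∈ Set.range x := ⟨Sum.inl 0, by simp [x]⟩
    rw [AffineSubspace.affineSpan_eq_top_iff_vectorSpan_eq_top_of_nonempty _ _ _ ⟨_, h0⟩,
      vectorSpan_eq_span_vsub_set_right ℝ h0, eq_top_iff, ← b.toBasis.span_eq]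
    refine Submodule.span_mono ?_
    rintro _ ⟨i, rfl⟩
    exact ⟨b i, ⟨Sum.inr i, rfl⟩, by simp⟩
  · rw [Finset.card_compl, hI]; simp; omega

theorem ofReal_norm_lt_of_mem_eball {V : Type*} [NormedAddCommGroup V] {R₀ : ENNReal} {v : V}
    (hv : v ∈ Metric.eball 0 R₀) : ENNReal.ofReal ‖v‖ < R₀ := by
  rwa [Metric.mem_eball, edist_zero_right, ← ofReal_norm] at hv

theorem Icc_subset_radii {R₀ : ENNReal} {M : ℝ} (hM : ENNReal.ofReal M < R₀) :
    Set.Icc 0 M ⊆ radii R₀ := fun _ hτ =>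
  ⟨hτ.1, (ENNReal.ofReal_le_ofReal hτ.2).trans_lt hM⟩

theorem closedBall_subset_eball_of_lt {V : Type*} [NormedAddCommGroup V] {R₀ : ENNReal} {M : ℝ}
    (hM : ENNReal.ofReal M < R₀) : Metric.closedBall (0 : V) M ⊆ Metric.eball 0 R₀ := fun v hv => by
  rw [Metric.mem_eball, edist_zero_right, ← ofReal_norm]
  exact (ENNReal.ofReal_le_ofReal (mem_closedBall_zero_iff.1 hv)).trans_lt hM

end Vertices

theorem mainTheorem11 (d : ℕ) (R₀ : ENNReal) (ρ : ℝ → ℝ)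
    (hρ : ∀ τ ∈ radii R₀, 0 ≤ ρ τ)
    (P : Set (EuclideanSpace ℝ (Fin d))) (hP : IsConvexPolytope P)
    (hV : (vertexSet P).ncard = d + 2) (hPD : P ⊆ Metric.eball 0 R₀) :
    (AntitoneOn ρ (radii R₀) →
      ∃ Q : Set (EuclideanSpace ℝ (Fin d)), IsOrthogonalRegularHull Q ∧
        Q ⊆ Metric.eball 0 R₀ ∧ circumradius Q = circumradius P ∧
        ∫ x in P, ρ ‖x‖ ≤ ∫ x in Q, ρ ‖x‖) ∧
    (MonotoneOn ρ (radii R₀) → (interior P).Nonempty →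
      ∃ Q : Set (EuclideanSpace ℝ (Fin d)), IsOrthogonalRegularHull Q ∧
        Q ⊆ Metric.eball 0 R₀ ∧ inradius Q = inradius P ∧
        ∫ x in Q, ρ ‖x‖ ≤ ∫ x in P, ρ ‖x‖) := by
  obtain ⟨x, hinj, hPx, hext⟩ := hP.exists_vertices (by omega) hV
  have hcard : Fintype.card (Fin (d + 2)) = d + 2 := Fintype.card_fin _
  have hcard' : Fintype.card (Fin (d + 2)) =
      Module.finrank ℝ (EuclideanSpace ℝ (Fin d)) + 2 := by
    rw [hcard, finrank_euclideanSpace_fin]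
  obtain ⟨I, w, hw⟩ := exists_isRadonDependence x hcard'
  rw [hPx] at hext
  have hI := hw.two_le_card hinj hext
  have hI' := hw.compl.two_le_card hinj hext
  have hd : 2 ≤ d := by
    have := Finset.card_add_card_compl I
    omega
  have : Nonempty (Fin d) := ⟨⟨0, by omega⟩⟩
  have hfin : Module.finrank ℝ (EuclideanSpace ℝ (Fin d)) = d := finrank_euclideanSpace_fin
  have : Nontrivial (EuclideanSpace ℝ (Fin d)) := 
    Module.nontrivial_of_finrank_pos (R := ℝ) (by omega)
  have hxP : ∀ k, x k ∈ P := fun k => hPx ▸ subset_convexHull ℝ _ ⟨k, rfl⟩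
  obtain ⟨k₀, -, hk₀⟩ := Finset.exists_max_image Finset.univ (fun k => ‖x k‖) Finset.univ_nonempty
  set M := ‖x k₀‖ with hM
  have hxM : ∀ k, ‖x k‖ ≤ M := fun k => hk₀ k (Finset.mem_univ k)
  have hM0 : 0 ≤ M := norm_nonneg _
  have hMR : ENNReal.ofReal M < R₀ := ofReal_norm_lt_of_mem_eball (hPD (hxP k₀))
  have hPM : P ⊆ Metric.closedBall 0 M := by
    rw [hPx, convexHull_range_subset_closedBall_iff]
    simpa using hxM
  have hPm : MeasurableSet P := by
    rw [hPx]; exact ((Set.finite_range x).isClosed_convexHull ℝ).measurableSet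
  constructor
  · intro hanti
    have hanti' := hanti.mono (Icc_subset_radii hMR)
    have hρ' : ∀ τ ∈ Set.Icc 0 M, 0 ≤ ρ τ := fun τ hτ => hρ τ (Icc_subset_radii hMR hτ)
    have hne : {r : ℝ | 0 ≤ r ∧ ∃ c, P ⊆ Metric.closedBall c r}.Nonempty := ⟨M, hM0, 0, hPM⟩
    have hRM : circumradius P ≤ M := csInf_le ⟨0, fun r hr => hr.1⟩ ⟨hM0, 0, hPM⟩
    have hR : 0 < circumradius P := by
      have h01 : x 0 ≠ x 1 := hinj.ne (by simp)
      refine (half_pos (dist_pos.2 h01)).trans_le (le_csInf hne ?_)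
      rintro r ⟨-, c, hc⟩
      have h0 := Metric.mem_closedBall.1 (hc (hxP 0))
      have h1 := Metric.mem_closedBall.1 (hc (hxP 1))
      have := dist_triangle_right (x 0) (x 1) c
      linarith
    by_cases hspan : affineSpan ℝ (Set.range x) = ⊤
    · obtain ⟨x', hx', ⟨w', hw'⟩, hsym⟩ := hw.exists_isConcentrated_mirror volume hcard' hspan
      have hspan' := hx'.affineSpan_eq_top hspan
      obtain ⟨Q, hQ, hQm, hQR, hQc, hQx⟩ :=
        hsym.exists_circumradius_eq hw' hcard hspan' hI hI' hR
      have hsub : convexHull ℝ (Set.range x') ⊆ Q := hQx fun k => by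
        refine le_csInf hne ?_
        rintro r ⟨-, c, hc⟩
        rw [hPx, convexHull_range_subset_closedBall_iff] at hc
        obtain ⟨c', -, hc'⟩ := hx'.circumscribed c r hc
        exact hsym.norm_le_of_subset_closedBall hw' hspan' hc' k
      have hQM : Q ⊆ Metric.closedBall 0 M := hQR.trans (Metric.closedBall_subset_closedBall hRM)
      refine ⟨Q, hQ, hQM.trans (closedBall_subset_eball_of_lt hMR), hQc, ?_⟩
      refine setIntegral_comp_norm_le_of_antitoneOn hPm hQm hPM hQM (fun t => ?_) hM0 hanti' hρ'
      rw [hPx]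
      exact (hx'.le_measure_inter t).trans (measure_mono (Set.inter_subset_inter_left _ hsub))
    · -- A polytope in a hyperplane has integral `0`, and any `Q` of the right circumradius will do.
      obtain ⟨y, J, v, hv, hyspan, hJ, hJ'⟩ := exists_nondegenerate_configuration hd
      have hcardy : Fintype.card (Fin 2 ⊕ Fin d) = d + 2 := by simp [add_comm]
      obtain ⟨x', hx', ⟨w', hw'⟩, hsym⟩ :=
        hv.exists_isConcentrated_mirror volume (by rw [hcardy, hfin]) hyspan
      obtain ⟨Q, hQ, hQm, hQR, hQc, -⟩ :=
        hsym.exists_circumradius_eq hw' hcardy (hx'.affineSpan_eq_top hyspan) hJ hJ' hR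
      have hQM : Q ⊆ Metric.closedBall 0 M := hQR.trans (Metric.closedBall_subset_closedBall hRM)
      refine ⟨Q, hQ, hQM.trans (closedBall_subset_eball_of_lt hMR), hQc, ?_⟩
      have h0 : volume P = 0 := by
        rw [affineSpan_eq_top_iff_measure_pos volume, not_lt, nonpos_iff_eq_zero] at hspan
        rw [hPx, hspan]
      rw [setIntegral_measure_zero _ h0]
      exact setIntegral_nonneg hQm fun a ha =>
        hρ' _ ⟨norm_nonneg a, mem_closedBall_zero_iff.1 (hQM ha)⟩
  · intro hmono hint
    have hmono' := hmono.mono (Icc_subset_radii hMR)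
    have hspan : affineSpan ℝ (Set.range x) = ⊤ := by
      rwa [hPx, interior_convexHull_nonempty_iff_affineSpan_eq_top] at hint
    obtain ⟨x', hx', ⟨w', hw'⟩, hsym⟩ := hw.exists_isConcentrated_mirror volume hcard' hspan
    have hspan' := hx'.affineSpan_eq_top hspan
    set Q₀ := convexHull ℝ (Set.range x') with hQ₀
    have hQ₀M : Q₀ ⊆ Metric.closedBall 0 M := by
      rw [hQ₀, convexHull_range_subset_closedBall_iff]
      simpa using hx'.norm_le hxM
    have hr : 0 < inradius P := by
      obtain ⟨c, hc⟩ := hint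
      obtain ⟨ε, hε, hcε⟩ :=
        Metric.nhds_basis_closedBall.mem_iff.1 (mem_interior_iff_mem_nhds.1 hc)
      exact hε.trans_le (le_csSup (bddAbove_inscribed_radii hPM) ⟨hε.le, c, hcε⟩)
    have hrle : inradius P ≤ inradius Q₀ := by
      obtain ⟨c, hc⟩ := hint
      refine csSup_le_csSup (bddAbove_inscribed_radii hQ₀M) ⟨0, le_rfl, c, ?_⟩ ?_
      · simpa using interior_subset hc
      · rintro r ⟨hr, c, hc⟩
        rw [hPx] at hc
        obtain ⟨c', -, hc'⟩ := hx'.inscribed c r hc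
        exact ⟨hr, c', hc'⟩
    have hr₀ := hr.trans_le hrle
    set t := inradius P / inradius Q₀ with ht
    have ht0 : 0 < t := div_pos hr hr₀
    have ht1 : t ≤ 1 := (div_le_one hr₀).2 hrle
    have hzero : (0 : EuclideanSpace ℝ (Fin d)) ∈ Q₀ :=
      hsym.zero_mem_convexHull hw' hspan' (Finset.card_pos.1 (by omega))
    have hQeq := convexHull_range_smul t x'
    have hsub : convexHull ℝ (Set.range (t • x')) ⊆ Q₀ := by
      rw [hQeq]
      rintro _ ⟨v, hv, rfl⟩
      exact (convex_convexHull ℝ _).smul_mem_of_zero_mem hzero hv ⟨ht0.le, ht1⟩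
    have hQm : ∀ y : Fin (d + 2) → EuclideanSpace ℝ (Fin d),
        MeasurableSet (convexHull ℝ (Set.range y)) := fun y =>
      ((Set.finite_range y).isClosed_convexHull ℝ).measurableSet
    refine ⟨convexHull ℝ (Set.range (t • x')),
      (hsym.smul ht0.ne').isOrthogonalRegularHull (hw'.smul t) hcard
        (affineSpan_range_smul hspan' ht0.ne') hI hI',
      (hsub.trans hQ₀M).trans (closedBall_subset_eball_of_lt hMR), ?_, ?_⟩
    · rw [hQeq, inradius_smul ht0, ht, div_mul_cancel₀ _ hr₀.ne']
    · calc ∫ x in convexHull ℝ (Set.range (t • x')), ρ ‖x‖ ≤ ∫ x in Q₀, ρ ‖x‖ := by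
            refine setIntegral_mono_set
              (integrableOn_comp_norm_of_monotoneOn (hQm x') hQ₀M hM0 hmono') ?_
              hsub.eventuallyLE
            rw [Filter.EventuallyLE, ae_restrict_iff' (hQm x')]
            exact Filter.Eventually.of_forall fun a ha => hρ _ (Icc_subset_radii hMR
              ⟨norm_nonneg a, mem_closedBall_zero_iff.1 (hQ₀M ha)⟩)
        _ ≤ ∫ x in P, ρ ‖x‖ := by
            refine setIntegral_comp_norm_le_of_monotoneOn hPm (hQm x') hPM hQ₀M (fun t => ?_) ?_
              hM0 hmono'
            · rw [hPx]; exact hx'.le_measure_inter t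
            · rw [hPx]; exact hx'.measure_le
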